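/- Let $C_d\ge 0$, $\mu\ge 0$, $\tau>0$, $\gamma>0$, $V>0$ and $0<c<1$. Consider on $(0,1)\times(0,\tau)$ the simply supported Euler–Bernoulli beam with Kelvin–Voigt damping $C_d$ and viscous damping $\mu$, $$\partial_{tt}w+\partial_{xx}\bigl(\partial_{xx}w+C_d\,\partial_{xxt}w\bigr)+\mu\,\partial_t w=r(x)u(t),$$ with $w=0$ and $\partial_{xx}w+C_d\partial_{xxt}w=0$ at $x=0,1$, written as $\dot z=Az+B(r)u$, $z(0)=z_0$, for $z=(w,v)=(w,\partial_t w)$ in the state space $H=(H^2(0,1)\cap H^1_0(0,1))\times L^2(0,1)$ with norm $\|(w,v)\|_H^2=\int_0^1(\partial_{xx}w)^2+w^2+v^2\,dx$. Here $A(w,v)=(v,-A_0(w+C_dv)-\mu v)$ with $D(A)=\{(w,v)\in H: v\in H^2(0,1)\cap H_0^1(0,1),\ w+C_dv\in D(A_0)\}$, where $A_0f=\partial_{xxxx}f$ and $D(A_0)=\{f\in H^4(0,1): f(0)=f(1)=\partial_{xx}f(0)=\partial_{xx}f(1)=0\}$, and $B(r)\in\mathcal L(\mathbb R,H)$ is $B(r)u=(0,ru)$.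 A weak solution is a $z\in L^2(0,\tau;H)$ such that for every $h\in D(A^*)$ the function $\langle h,z(\cdot)\rangle$ is in $H^1(0,\tau)$, has the initial value $\langle h,z_0\rangle$, and satisfies $\frac{d}{dt}\langle h,z(t)\rangle=\langle A^*h,z(t)\rangle+\langle h,B(r)u(t)\rangle$ for almost every $t\in(0,\tau)$. Let $$K_{ad}=\{\chi_\omega:\ \omega\subseteq[0,1]\text{ Lebesgue measurable},\ \mathrm{Var}(\chi_\omega,[0,1])\le V,\ |\omega|=c\}\subset L^\infty(0,1).$$ Then: 1. $K_{ad}$ is compact in $L^\infty(0,1)=L^1(0,1)^*$ with the weak-* topology. 2. For all $r_1,r_2\in K_{ad}$, $\|B(r_2)-B(r_1)\|_{\mathcal L(\mathbb R,H)}=\bigl(\int_0^1(r_2(x)-r_1(x))^2\,dx\bigr)^{1/2}$, and the map $r\mapsto B(r)$ is continuous on $K_{ad}$ from the weak-* topology to the operator norm. 3. Let $z_0\in H$. For all $r\in K_{ad}$ and $u\in L^2(0,\tau)$ there is exactly one weak solution $z$. For every $r\in K_{ad}$ the minimum $$J_1(r,z_0)=\min_{u\in L^2(0,\tau)}\int_0^\tau\|z(t)\|_H^2+\gamma|u(t)|^2\,dt$$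 (with $z$ the weak solution for $r$ and $u$) is attained. If $K_{ad}$ is nonempty, there exist an optimal actuator shape $r^*\in K_{ad}$ and an optimal control $u^*\in L^2(0,\tau)$: $J_1(r^*,z_0)\le J_1(r,z_0)$ for all $r\in K_{ad}$, and $u^*$ attains the minimum that defines $J_1(r^*,z_0)$. -/

import Mathlib

open MeasureTheory Set Filter
open scoped ENNReal ContDiff

noncomputable section

namespace Beam

/-! ### Function spaces on the unit interval -/

/-- Lebesgue measure on `(0,1)`. -/
def unitMeasure : Measure ℝ := volume.restrict (Ioo 0 1)

instance : IsFiniteMeasure unitMeasure := by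
  unfold unitMeasure; infer_instance

/-- The real space `L²(0,1)`. -/
abbrev L2 : Type := Lp ℝ 2 unitMeasure

/-- Test functions: smooth, with compact support contained in `(0,1)`. -/
structure IsTestFunction (φ : ℝ → ℝ) : Prop where
  smooth : ContDiff ℝ ∞ φ
  compact : HasCompactSupport φ
  support : tsupport φ ⊆ Ioo 0 1

/-- `g` is the weak derivative of `f` on `(0,1)`; both are in `L²(0,1)`. -/
def HasWeakDeriv (f g : L2) : Prop :=
  ∀ φ : ℝ → ℝ, IsTestFunction φ →
    ∫ x, f x * deriv φ x ∂unitMeasure = -∫ x, g x * φ x ∂unitMeasure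

/-- `f(0) = f(1) = 0`: the class `f` has a representative that is continuous on `[0,1]` and
vanishes at both end points. -/
def VanishesAtEnds (f : L2) : Prop :=
  ∃ F : ℝ → ℝ, ContinuousOn F (Icc 0 1) ∧ f =ᵐ[unitMeasure] F ∧ F 0 = 0 ∧ F 1 = 0

/-- `f ∈ H²(0,1) ∩ H¹₀(0,1)` with `∂ₓₓ f = g`. -/
def IsH2H10 (f g : L2) : Prop :=
  (∃ f₁ : L2, HasWeakDeriv f f₁ ∧ HasWeakDeriv f₁ g) ∧ VanishesAtEnds f

/-- `f ∈ D(A₀)` and `A₀ f = g`, where `A₀ f = ∂ₓₓₓₓ f` and `D(A₀)` consists of the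
`f ∈ H⁴(0,1)` with `f(0) = f(1) = 0` and `∂ₓₓ f(0) = ∂ₓₓ f(1) = 0`. -/
def IsBiharmonic (f g : L2) : Prop :=
  ∃ f₁ f₂ f₃ : L2, HasWeakDeriv f f₁ ∧ HasWeakDeriv f₁ f₂ ∧ HasWeakDeriv f₂ f₃ ∧
    HasWeakDeriv f₃ g ∧ VanishesAtEnds f ∧ VanishesAtEnds f₂

theorem integrable_mul_test (f : L2) {ψ : ℝ → ℝ} (hc : Continuous ψ) (hs : HasCompactSupport ψ) :
    Integrable (fun x => f x * ψ x) unitMeasure :=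
  (Lp.memLp f).integrable_mul (hc.memLp_of_hasCompactSupport (p := 2) hs)

theorem IsTestFunction.deriv_continuous {φ : ℝ → ℝ} (h : IsTestFunction φ) :
    Continuous (deriv φ) :=
  h.smooth.continuous_deriv (by simp)

theorem integral_add_mul_test (f g : L2) {ψ : ℝ → ℝ} (hc : Continuous ψ)
    (hs : HasCompactSupport ψ) :
    ∫ x, (f + g : L2) x * ψ x ∂unitMeasure
      = ∫ x, f x * ψ x ∂unitMeasure + ∫ x, g x * ψ x ∂unitMeasure := by
  rw [← integral_add (integrable_mul_test f hc hs) (integrable_mul_test g hc hs)]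
  refine integral_congr_ae ?_
  filter_upwards [Lp.coeFn_add f g] with x hx
  rw [hx, Pi.add_apply, add_mul]

theorem integral_smul_mul_test (a : ℝ) (f : L2) (ψ : ℝ → ℝ) :
    ∫ x, (a • f : L2) x * ψ x ∂unitMeasure = a * ∫ x, f x * ψ x ∂unitMeasure := by
  rw [← integral_const_mul]
  refine integral_congr_ae ?_
  filter_upwards [Lp.coeFn_smul a f] with x hx
  rw [hx, Pi.smul_apply, smul_eq_mul, mul_assoc]

theorem HasWeakDeriv.add {f g f' g' : L2} (h : HasWeakDeriv f g) (h' : HasWeakDeriv f' g') :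
    HasWeakDeriv (f + f') (g + g') := by
  intro φ hφ
  rw [integral_add_mul_test _ _ hφ.deriv_continuous hφ.compact.deriv,
    integral_add_mul_test _ _ hφ.smooth.continuous hφ.compact, h φ hφ, h' φ hφ]
  ring

theorem HasWeakDeriv.smul (a : ℝ) {f g : L2} (h : HasWeakDeriv f g) :
    HasWeakDeriv (a • f) (a • g) := by
  intro φ hφ
  rw [integral_smul_mul_test, integral_smul_mul_test, h φ hφ]
  ring

theorem IsH2H10.add {f g f' g' : L2} (h : IsH2H10 f g) (h' : IsH2H10 f' g') :
    IsH2H10 (f + f') (g + g') := by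
  obtain ⟨⟨p, h1, h2⟩, F, hF, hfF, hF0, hF1⟩ := h
  obtain ⟨⟨p', h1', h2'⟩, F', hF', hfF', hF0', hF1'⟩ := h'
  refine ⟨⟨p + p', h1.add h1', h2.add h2'⟩, F + F', hF.add hF', ?_, by simp [hF0, hF0'],
    by simp [hF1, hF1']⟩
  exact (Lp.coeFn_add f f').trans (hfF.add hfF')

theorem IsH2H10.smul (a : ℝ) {f g : L2} (h : IsH2H10 f g) : IsH2H10 (a • f) (a • g) := by
  obtain ⟨⟨p, h1, h2⟩, F, hF, hfF, hF0, hF1⟩ := h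
  refine ⟨⟨a • p, h1.smul a, h2.smul a⟩, a • F, hF.const_smul a, ?_, by simp [hF0],
    by simp [hF1]⟩
  exact (Lp.coeFn_smul a f).trans (hfF.const_smul a)

theorem IsH2H10.zero : IsH2H10 0 0 := by
  have h : HasWeakDeriv 0 0 := by
    intro φ _
    have e : ∀ ψ : ℝ → ℝ, ∫ x, (0 : L2) x * ψ x ∂unitMeasure = 0 := by
      intro ψ
      simpa using integral_smul_mul_test 0 (0 : L2) ψ
    rw [e, e, neg_zero]
  exact ⟨⟨0, h, h⟩, 0, continuousOn_const, Lp.coeFn_zero _ _ _, rfl, rfl⟩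

/-! ### The state space -/

/-- The state space `H = (H²(0,1) ∩ H¹₀(0,1)) × L²(0,1)`. A state `(w, v)` is stored as the triple
`(w, ∂ₓₓ w, v)` in `L² × L² × L²` with the `ℓ²` norm, the middle entry being determined by `w`.
The inherited norm is `‖(w,v)‖² = ∫₀¹ (∂ₓₓ w)² + w² + v² dx`. -/
def stateSpace : Submodule ℝ (PiLp 2 (fun _ : Fin 3 => L2)) where
  carrier := {z | IsH2H10 (z 0) (z 1)}
  zero_mem' := IsH2H10.zero
  add_mem' := fun h h' => h.add h'
  smul_mem' := fun a _ h => h.smul a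

/-- The state space as a real inner product space. -/
abbrev H : Type := stateSpace

/-- The displacement `w` of a state `(w, v)`. -/
def disp (z : H) : L2 := z.1 0

/-- The velocity `v` of a state `(w, v)`. -/
def vel (z : H) : L2 := z.1 2

/-- The graph of the state operator: `(w,v) ∈ D(A)` and `A (w,v) = y`, where
`A (w,v) = (v, -A₀ (w + C_d v) - μ v)` and `D(A)` consists of the `(w,v) ∈ H` with
`v ∈ H² ∩ H¹₀` and `w + C_d v ∈ D(A₀)`. -/
def IsGenerator (Cd mu : ℝ) (z y : H) : Prop :=
  ∃ v₂ g : L2, IsH2H10 (vel z) v₂ ∧ IsBiharmonic (disp z + Cd • vel z) g ∧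
    disp y = vel z ∧ vel y = -g - mu • vel z

/-- The graph of the adjoint operator: `h ∈ D(A*)` and `A* h = g`. -/
def IsAdjoint (Cd mu : ℝ) (h g : H) : Prop :=
  ∀ z y : H, IsGenerator Cd mu z y → inner ℝ y h = inner ℝ z g

/-! ### Actuator shapes -/

/-- The space `K = L^∞(0,1)`, to be equipped with the weak-* topology. -/
def K : Type := Lp ℝ ∞ unitMeasure

/-- The class `r ∈ L^∞(0,1)` as a function defined almost everywhere. -/
def K.fn (r : K) : ℝ → ℝ := ((show Lp ℝ ∞ unitMeasure from r : ℝ →ₘ[unitMeasure] ℝ) : ℝ → ℝ)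

theorem K.memLp (r : K) : MemLp r.fn ∞ unitMeasure :=
  Lp.memLp (show Lp ℝ ∞ unitMeasure from r)

/-- The weak-* topology of `L^∞(0,1)` as the dual of `L¹(0,1)`: the coarsest topology for which
`r ↦ ∫₀¹ r f dx` is continuous for every `f ∈ L¹(0,1)`. -/
instance : TopologicalSpace K :=
  TopologicalSpace.induced
    (fun (r : K) (f : Lp ℝ 1 unitMeasure) => ∫ x, r.fn x * f x ∂unitMeasure) Pi.topologicalSpace

/-- The admissible actuator shapes: the indicator functions `χ_S` of measurable `S ⊆ [0,1]` with
`Var(χ_S, [0,1]) ≤ V` and `|S| = c`, as elements of `L^∞(0,1)`. -/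
def Kad (V c : ℝ) : Set K :=
  {r | ∃ S : Set ℝ, MeasurableSet S ∧ S ⊆ Icc 0 1 ∧
    r.fn =ᵐ[unitMeasure] S.indicator (fun _ => (1 : ℝ)) ∧
    eVariationOn (S.indicator (fun _ => (1 : ℝ))) (Icc 0 1) ≤ ENNReal.ofReal V ∧
    volume S = ENNReal.ofReal c}

/-- The state `(0, r)`, for `r ∈ L^∞(0,1) ⊆ L²(0,1)`. -/
def inputState (r : K) : H :=
  ⟨WithLp.toLp 2 ![0, 0, (r.memLp.mono_exponent le_top).toLp r.fn], IsH2H10.zero⟩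

/-- The input operator `B(r) : ℝ → H`, `B(r) u = (0, r u)`. -/
def inputOp (r : K) : ℝ →L[ℝ] H := ContinuousLinearMap.toSpanSingleton ℝ (inputState r)

/-! ### The controlled beam and the cost -/

/-- Lebesgue measure on `(0,τ)`. -/
def timeMeasure (τ : ℝ) : Measure ℝ := volume.restrict (Ioo 0 τ)

/-- `z ∈ L²(0,τ;H)` is a weak solution of `z' = A z + B(r) u`, `z(0) = z₀`: for every `h ∈ D(A*)`
the function `t ↦ ⟪h, z(t)⟫` is in `H¹(0,τ)` (it has an absolutely continuous representative `F`
whose derivative, being almost everywhere the right-hand side below, is in `L²`), its derivative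
is `⟪A* h, z(t)⟫ + ⟪h, B(r) u(t)⟫` almost everywhere, and its initial value is `⟪h, z₀⟫`. -/
def IsWeakSolution (Cd mu τ : ℝ) (r : K) (u : Lp ℝ 2 (timeMeasure τ)) (z₀ : H)
    (z : Lp H 2 (timeMeasure τ)) : Prop :=
  ∀ h g : H, IsAdjoint Cd mu h g →
    ∃ F : ℝ → ℝ, AbsolutelyContinuousOnInterval F 0 τ ∧
      (∀ᵐ t ∂timeMeasure τ, F t = inner ℝ h (z t)) ∧
      (∀ᵐ t ∂timeMeasure τ,
        HasDerivAt F (inner ℝ g (z t) + inner ℝ h (inputOp r (u t))) t) ∧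
      F 0 = inner ℝ h z₀

/-- The linear-quadratic cost `∫₀^τ ‖z(t)‖_H² + γ |u(t)|² dt`. -/
def cost (γ τ : ℝ) (u : Lp ℝ 2 (timeMeasure τ)) (z : Lp H 2 (timeMeasure τ)) : ℝ :=
  ∫ t, (‖z t‖ ^ 2 + γ * |u t| ^ 2) ∂timeMeasure τ

/-- All costs that can be achieved with the actuator shape `r` and a control `u ∈ L²(0,τ)`. -/
def costValues (Cd mu τ γ : ℝ) (z₀ : H) (r : K) : Set ℝ :=
  {j | ∃ (u : Lp ℝ 2 (timeMeasure τ)) (z : Lp H 2 (timeMeasure τ)),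
    IsWeakSolution Cd mu τ r u z₀ z ∧ j = cost γ τ u z}

/-- The optimal cost `J₁(r, z₀)` for the actuator shape `r`. -/
def J1 (Cd mu τ γ : ℝ) (z₀ : H) (r : K) : ℝ := sInf (costValues Cd mu τ γ z₀ r)

end Beam

end

noncomputable section

namespace Beam

open scoped Topology

/-! ### Primitives of square integrable functions -/

section Primitive

variable {τ : ℝ} {E : Type*} [NormedAddCommGroup E]

/-! Compactness of the shapes. Let `T` be the pointwise limit of the representing sets along an
ultrafilter. Variation is lower semicontinuous under pointwise convergence, so `T` obeys the same
bound and is measurable. Two sets of variation at most `W` that agree at `n` equispaced points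
differ by measure at most `2W/n` (`volume_symmDiff_le`), so the symmetric differences tend to zero.
This gives both `|T| = c` and weak-* convergence (`isCompact_Kad`).

Continuity of the input. Indicators are idempotent and have the common integral `c`, so `∫ (r - s)²
= 2(c - ∫ r s)`. For fixed `s` the right-hand side is weak-* continuous in `r`; on this set weak-*
convergence is therefore `L²` convergence.

Well-posedness. The functions `√2 sin((n+1)πx)` are complete in `L²(0,1)` and diagonalise `∂ₓₓ` and
`∂ₓₓₓₓ` under the given boundary conditions (`isH2H10_iff`). Truncation to `N` modes commutes with
the beam operator. The truncated operators `A N` satisfy `⟨A N z, z⟩ ≤ ½‖z‖²` uniformly in `N`,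
because the stiff terms cancel in the energy and damping only helps (`isGalerkin_modal`). The rest
is abstract: weak solutions form a closed linear graph, projection of the weak equation reduces
uniqueness to a bounded equation, and the uniform energy estimate makes Galerkin solutions Cauchy
(`IsGalerkin.exists_weak`).

Optimisation. For fixed `r` the admissible pairs `(u, z)` form a closed affine set, and the cost is
a squared Hilbert norm, so the minimum exists. Its square root is Lipschitz in the input vector
(`IsGalerkin.exists_sqrt_lqCosts_le`). It is thus weak-* continuous on the compact set of shapes and
attains its minimum there. -/

instance (τ : ℝ) : IsFiniteMeasure (timeMeasure τ) := by
  unfold timeMeasure; infer_instance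

theorem timeMeasure_eq_restrict_Ioc (τ : ℝ) : timeMeasure τ = volume.restrict (Ioc 0 τ) :=
  Measure.restrict_congr_set Ioo_ae_eq_Ioc

theorem ae_timeMeasure_iff {p : ℝ → Prop} :
    (∀ᵐ t ∂timeMeasure τ, p t) ↔ ∀ᵐ t, t ∈ Ioo 0 τ → p t :=
  ae_restrict_iff' measurableSet_Ioo

theorem Lp_integrable (f : Lp E 2 (timeMeasure τ)) : Integrable f (timeMeasure τ) :=
  (Lp.memLp f).integrable one_le_two

theorem intervalIntegrable_of_timeMeasure (hτ : 0 ≤ τ) {f : ℝ → E}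
    (hf : Integrable f (timeMeasure τ)) : IntervalIntegrable f volume 0 τ := by
  rw [timeMeasure_eq_restrict_Ioc] at hf
  rwa [intervalIntegrable_iff_integrableOn_Ioc_of_le hτ]

theorem intervalIntegrable_of_timeMeasure' {f : ℝ → E}
    (hf : Integrable f (timeMeasure τ)) {t : ℝ} (ht : t ∈ Icc 0 τ) :
    IntervalIntegrable f volume 0 t := by
  refine (intervalIntegrable_of_timeMeasure (ht.1.trans ht.2) hf).mono_set ?_
  rw [uIcc_of_le ht.1, uIcc_of_le (ht.1.trans ht.2)]
  exact Icc_subset_Icc_right ht.2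

theorem integral_timeMeasure [NormedSpace ℝ E] (hτ : 0 ≤ τ) (f : ℝ → E) :
    ∫ t, f t ∂timeMeasure τ = ∫ t in 0..τ, f t := by
  rw [timeMeasure_eq_restrict_Ioc, intervalIntegral.integral_of_le hτ]

theorem intervalIntegral_congr_timeMeasure [NormedSpace ℝ E] {f g : ℝ → E}
    (h : f =ᵐ[timeMeasure τ] g) {t : ℝ} (ht : t ∈ Icc 0 τ) :
    ∫ s in 0..t, f s = ∫ s in 0..t, g s := by
  refine intervalIntegral.integral_congr_ae_restrict ?_
  rw [timeMeasure_eq_restrict_Ioc] at h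
  rw [uIoc_of_le ht.1]
  exact ae_restrict_of_ae_restrict_of_subset (Ioc_subset_Ioc_right ht.2) h

theorem absolutelyContinuous_primitive (hτ : 0 ≤ τ) {f : ℝ → ℝ}
    (hf : Integrable f (timeMeasure τ)) :
    AbsolutelyContinuousOnInterval (fun t => ∫ s in 0..t, f s) 0 τ :=
  (intervalIntegrable_of_timeMeasure hτ hf).absolutelyContinuousOnInterval_intervalIntegral
    (by simp)

theorem hasDerivAt_primitive (hτ : 0 ≤ τ) {f : ℝ → ℝ} (hf : Integrable f (timeMeasure τ)) :
    ∀ᵐ t ∂timeMeasure τ, HasDerivAt (fun t => ∫ s in 0..t, f s) (f t) t := by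
  rw [ae_timeMeasure_iff]
  filter_upwards [(intervalIntegrable_of_timeMeasure hτ hf).ae_hasDerivAt_integral] with t ht h
  refine ht ?_ 0 (by simp)
  rw [uIcc_of_le hτ]
  exact Ioo_subset_Icc_self h

theorem continuousOn_primitive_timeMeasure (hτ : 0 ≤ τ) {f : ℝ → ℝ}
    (hf : Integrable f (timeMeasure τ)) :
    ContinuousOn (fun t => ∫ s in 0..t, f s) (Icc 0 τ) := by
  simpa [uIcc_of_le hτ] using (absolutelyContinuous_primitive hτ hf).continuousOn

/-- Cauchy–Schwarz against the indicator of `Iic t`. The bound is uniform in `t`, which makes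
integration a bounded operator on `L²(0,τ)`. -/
theorem abs_primitive_le (f : Lp ℝ 2 (timeMeasure τ)) {t : ℝ} (ht : t ∈ Ioo 0 τ) :
    |∫ s in 0..t, f s| ≤ (timeMeasure τ).real univ ^ (1 / 2 : ℝ) * ‖f‖ := by
  have e : ∫ s in 0..t, f s
      = inner ℝ (indicatorConstLp 2 (measurableSet_Iic (a := t))
        (measure_ne_top (timeMeasure τ) _) (1 : ℝ)) f := by
    have hm : (timeMeasure τ).restrict (Iic t) = volume.restrict (Ioc 0 t) := by
      rw [timeMeasure, Measure.restrict_restrict measurableSet_Iic]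
      congr 1
      ext s
      simp only [mem_Ioc, mem_inter_iff, mem_Iic, mem_Ioo]
      exact ⟨fun h => ⟨h.2.1, h.1⟩, fun h => ⟨h.2, h.1, h.2.trans_lt ht.2⟩⟩
    rw [L2.inner_indicatorConstLp_one, intervalIntegral.integral_of_le ht.1.le, hm]
  rw [e]
  refine (abs_real_inner_le_norm _ _).trans ?_
  gcongr
  rw [norm_indicatorConstLp (by norm_num) (by norm_num)]
  simp only [norm_one, one_mul, ENNReal.toReal_ofNat]
  gcongr
  · exact measure_ne_top _ _
  · exact subset_univ _

theorem memLp_primitive (hτ : 0 ≤ τ) (f : Lp ℝ 2 (timeMeasure τ)) :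
    MemLp (fun t => ∫ s in 0..t, f s) 2 (timeMeasure τ) := by
  refine MemLp.of_bound
    (((continuousOn_primitive_timeMeasure hτ (Lp_integrable f)).mono
      Ioo_subset_Icc_self).aestronglyMeasurable measurableSet_Ioo)
    ((timeMeasure τ).real univ ^ (1 / 2 : ℝ) * ‖f‖) ?_
  filter_upwards [ae_restrict_mem measurableSet_Ioo] with t ht
  exact abs_primitive_le f ht

/-- The integration operator `f ↦ ∫₀ᵗ f` on `L²(0,τ)`. -/
def primitive (hτ : 0 ≤ τ) : Lp ℝ 2 (timeMeasure τ) →L[ℝ] Lp ℝ 2 (timeMeasure τ) :=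
  LinearMap.mkContinuous
    { toFun := fun f => (memLp_primitive hτ f).toLp _
      map_add' := fun f g => by
        rw [← MemLp.toLp_add]
        refine MemLp.toLp_congr _ _ ?_
        filter_upwards [ae_restrict_mem measurableSet_Ioo] with t ht
        have ht' := Ioo_subset_Icc_self ht
        rw [intervalIntegral_congr_timeMeasure (Lp.coeFn_add f g) ht']
        exact intervalIntegral.integral_add
          (intervalIntegrable_of_timeMeasure' (Lp_integrable f) ht')
          (intervalIntegrable_of_timeMeasure' (Lp_integrable g) ht')
      map_smul' := fun a f => by
        rw [RingHom.id_apply, ← MemLp.toLp_const_smul]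
        refine MemLp.toLp_congr _ _ ?_
        filter_upwards [ae_restrict_mem measurableSet_Ioo] with t ht
        rw [intervalIntegral_congr_timeMeasure (Lp.coeFn_smul a f) (Ioo_subset_Icc_self ht)]
        exact intervalIntegral.integral_smul a _ }
    (measureUnivNNReal (timeMeasure τ) ^ (2 : ℝ≥0∞).toReal⁻¹
      * (timeMeasure τ).real univ ^ (1 / 2 : ℝ))
    (fun f => by
      rw [mul_assoc]
      refine Lp.norm_le_of_ae_bound (by positivity) ?_
      filter_upwards [(memLp_primitive hτ f).coeFn_toLp, ae_restrict_mem measurableSet_Ioo]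
        with t ht ht'
      simp only [LinearMap.coe_mk, AddHom.coe_mk]
      rw [ht]
      exact abs_primitive_le f ht')

theorem coeFn_primitive (hτ : 0 ≤ τ) (f : Lp ℝ 2 (timeMeasure τ)) :
    primitive hτ f =ᵐ[timeMeasure τ] fun t => ∫ s in 0..t, f s :=
  (memLp_primitive hτ f).coeFn_toLp

end Primitive

/-! ### Weak solutions of abstract evolution equations -/

section Evolution

variable {τ : ℝ} {E : Type*} [NormedAddCommGroup E] [InnerProductSpace ℝ E]

/-- The adjoint relation of a relation `gen` on a Hilbert space. -/
def adjRel (gen : E → E → Prop) (h g : E) : Prop :=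
  ∀ z y, gen z y → inner ℝ y h = inner ℝ z g

/-- The defect of the weak formulation of `z' = A z + f`, `z(0) = z₀`, tested with `h`, where
`g = A* h`. -/
def weakDefect (hτ : 0 ≤ τ) (h g : E) :
    E × Lp E 2 (timeMeasure τ) × Lp E 2 (timeMeasure τ) →L[ℝ] Lp ℝ 2 (timeMeasure τ) :=
  (innerSL ℝ h).compLpL 2 (timeMeasure τ) ∘L .snd ℝ _ _ ∘L .snd ℝ _ _
    - Lp.constL 2 (timeMeasure τ) ℝ ∘L innerSL ℝ h ∘L .fst ℝ _ _
    - primitive hτ ∘L ((innerSL ℝ g).compLpL 2 (timeMeasure τ) ∘L .snd ℝ _ _ ∘L .snd ℝ _ _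
      + (innerSL ℝ h).compLpL 2 (timeMeasure τ) ∘L .fst ℝ _ _ ∘L .snd ℝ _ _)

/-- The triples `(z₀, f, z)` such that `z` is a weak solution of `z' = A z + f`, `z(0) = z₀`. -/
def weakGraph (gen : E → E → Prop) (hτ : 0 ≤ τ) :
    Submodule ℝ (E × Lp E 2 (timeMeasure τ) × Lp E 2 (timeMeasure τ)) :=
  ⨅ (h : E) (g : E) (_ : adjRel gen h g), (weakDefect hτ h g).ker

/-- Each test pair contributes the kernel of a continuous linear map into `L²(0,τ)`. Linearity gives
superposition of weak solutions, and closedness allows passage to the limit in Galerkin solutions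
and makes the admissible set of the control problem closed. -/
theorem isClosed_weakGraph (gen : E → E → Prop) (hτ : 0 ≤ τ) :
    IsClosed (weakGraph gen hτ : Set (E × Lp E 2 (timeMeasure τ) × Lp E 2 (timeMeasure τ))) := by
  simp only [weakGraph, Submodule.coe_iInf]
  exact isClosed_iInter fun h => isClosed_iInter fun g => isClosed_iInter fun _ =>
    (weakDefect hτ h g).isClosed_ker

theorem weakDefect_eq_zero_iff (hτ : 0 ≤ τ) (h g z₀ : E) (f z : Lp E 2 (timeMeasure τ)) :
    weakDefect hτ h g (z₀, f, z) = 0 ↔ ∀ᵐ t ∂timeMeasure τ,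
      inner ℝ h (z t) = inner ℝ h z₀ + ∫ s in 0..t, (inner ℝ g (z s) + inner ℝ h (f s)) := by
  have e : weakDefect hτ h g (z₀, f, z)
      = (innerSL ℝ h).compLpL 2 (timeMeasure τ) z - Lp.constL 2 (timeMeasure τ) ℝ (inner ℝ h z₀)
        - primitive hτ ((innerSL ℝ g).compLpL 2 (timeMeasure τ) z
          + (innerSL ℝ h).compLpL 2 (timeMeasure τ) f) := rfl
  rw [e, sub_sub, sub_eq_zero]
  have h1 := (innerSL ℝ h).coeFn_compLpL (p := 2) z
  have h2 := (innerSL ℝ g).coeFn_compLpL (p := 2) z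
  have h3 := (innerSL ℝ h).coeFn_compLpL (p := 2) f
  have h4 := Lp.coeFn_add ((innerSL ℝ g).compLpL 2 (timeMeasure τ) z)
    ((innerSL ℝ h).compLpL 2 (timeMeasure τ) f)
  have h5 := coeFn_primitive hτ ((innerSL ℝ g).compLpL 2 (timeMeasure τ) z
          + (innerSL ℝ h).compLpL 2 (timeMeasure τ) f)
  have h6 := Lp.coeFn_add (Lp.constL 2 (timeMeasure τ) ℝ (inner ℝ h z₀))
    (primitive hτ ((innerSL ℝ g).compLpL 2 (timeMeasure τ) z
          + (innerSL ℝ h).compLpL 2 (timeMeasure τ) f))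
  have h7 := Lp.coeFn_const 2 (timeMeasure τ) (inner ℝ h z₀)
  have h8 : (fun s => ((innerSL ℝ g).compLpL 2 (timeMeasure τ) z
          + (innerSL ℝ h).compLpL 2 (timeMeasure τ) f : Lp ℝ 2 (timeMeasure τ)) s)
      =ᵐ[timeMeasure τ] fun s => inner ℝ g (z s) + inner ℝ h (f s) := by
    filter_upwards [h2, h3, h4] with s h2 h3 h4
    rw [h4, Pi.add_apply, h2, h3]; rfl
  rw [Lp.ext_iff]
  refine eventually_congr ?_
  filter_upwards [h1, h5, h6, h7, ae_restrict_mem measurableSet_Ioo] with t h1 h5 h6 h7 ht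
  rw [h1, h6, Pi.add_apply, h5]
  erw [h7]
  rw [intervalIntegral_congr_timeMeasure h8 (Ioo_subset_Icc_self ht)]
  rfl

theorem mem_weakGraph_iff {gen : E → E → Prop} {hτ : 0 ≤ τ} {z₀ : E}
    {f z : Lp E 2 (timeMeasure τ)} :
    (z₀, f, z) ∈ weakGraph gen hτ ↔ ∀ h g, adjRel gen h g → ∀ᵐ t ∂timeMeasure τ,
      inner ℝ h (z t) = inner ℝ h z₀ + ∫ s in 0..t, (inner ℝ g (z s) + inner ℝ h (f s)) := by
  simp only [weakGraph, Submodule.mem_iInf, LinearMap.mem_ker, ContinuousLinearMap.coe_coe,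
    weakDefect_eq_zero_iff]

end Evolution

/-! ### Galerkin approximation: existence, uniqueness and a priori bound for weak solutions. -/

section Galerkin

variable {τ : ℝ} {E : Type*} [NormedAddCommGroup E] [InnerProductSpace ℝ E]

/-- Bounded approximations `A N` of the operator with graph `gen`, together with projections `P N`
that reduce it. -/
structure IsGalerkin (gen : E → E → Prop) (P A : ℕ → E →L[ℝ] E) (β : ℝ) : Prop where
  gen_apply : ∀ N z, gen (P N z) (A N z)
  proj_eq : ∀ N z y, gen z y → P N y = A N z
  tendsto_proj : ∀ z, Tendsto (fun N => P N z) atTop (𝓝 z)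
  proj_proj : ∀ M N z, M ≤ N → P N (P M z) = P M z
  apply_proj : ∀ N z, A N (P N z) = A N z
  nonneg : 0 ≤ β
  inner_le : ∀ N z, inner ℝ (A N z) z ≤ β * ‖z‖ ^ 2

/-- Solvability of the inhomogeneous linear initial value problem with a bounded operator. -/
theorem exists_linear_ode [CompleteSpace E] (A : E →L[ℝ] E) (x₀ : E) {f : ℝ → E}
    (hf : Continuous f) :
    ∃ y : ℝ → E, y 0 = x₀ ∧ ∀ t, HasDerivAt y (A (y t) + f t) t := by
  have hexp : ∀ t : ℝ, HasDerivAt (fun t : ℝ => NormedSpace.exp (t • A))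
      (A * NormedSpace.exp (t • A)) t := hasDerivAt_exp_smul_const' A
  have hcont : Continuous fun s : ℝ => NormedSpace.exp ((-s) • A) (f s) := by
    have h1 : Continuous fun t : ℝ => NormedSpace.exp (t • A) :=
      continuous_iff_continuousAt.2 fun t => (hexp t).continuousAt
    exact (h1.comp continuous_neg).clm_apply hf
  -- Variation of constants, with the factor `exp(tA)` pulled out of the integral so that the
  -- product rule applies.
  refine ⟨fun t => NormedSpace.exp (t • A) (x₀ + ∫ s in 0..t, NormedSpace.exp ((-s) • A) (f s)),
    by simp, fun t => ?_⟩
  have h2 : HasDerivAt (fun t : ℝ => x₀ + ∫ s in 0..t, NormedSpace.exp ((-s) • A) (f s))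
      (NormedSpace.exp ((-t) • A) (f t)) t :=
    (hcont.integral_hasStrictDerivAt 0 t).hasDerivAt.const_add x₀
  convert (hexp t).clm_apply h2 using 1
  let _ : NormedAlgebra ℚ (E →L[ℝ] E) := NormedAlgebra.restrictScalars ℚ ℝ _
  have h3 : NormedSpace.exp (t • A) * NormedSpace.exp ((-t) • A) = 1 := by
    rw [← NormedSpace.exp_add_of_commute]
    · simp
    · exact ((Commute.refl A).smul_left t).smul_right (-t)
  rw [← mul_apply_eq_comp _ _ (f t), h3]
  rfl

/-- Energy method: `exp(-κ s)‖y‖² - ∫₀ˢ ‖f‖²` is nonincreasing for `κ = 2β + 1`. The `2β` absorbs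
`2⟨A y, y⟩` and the `1` comes from `2⟨y, f⟩ ≤ ‖y‖² + ‖f‖²`. The bound does not see `‖A‖`, hence is
uniform over the Galerkin operators. -/
theorem norm_sq_le_of_ode {A : E →L[ℝ] E} {β : ℝ} (hβ : 0 ≤ β)
    (hA : ∀ z, inner ℝ (A z) z ≤ β * ‖z‖ ^ 2) {f y : ℝ → E} (hf : Continuous f)
    (hy : ∀ t, HasDerivAt y (A (y t) + f t) t) {t : ℝ} (ht : t ∈ Icc 0 τ) :
    ‖y t‖ ^ 2 ≤ Real.exp ((2 * β + 1) * τ) * (‖y 0‖ ^ 2 + ∫ s in 0..τ, ‖f s‖ ^ 2) := by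
  set κ := 2 * β + 1 with hκ
  have hf2 : Continuous fun s => ‖f s‖ ^ 2 := hf.norm.pow 2
  have hd : ∀ s, HasDerivAt (fun s => Real.exp (-κ * s) * ‖y s‖ ^ 2 - ∫ r in 0..s, ‖f r‖ ^ 2)
      (Real.exp (-κ * s) * (-κ) * ‖y s‖ ^ 2
        + Real.exp (-κ * s) * (2 * inner ℝ (y s) (A (y s) + f s)) - ‖f s‖ ^ 2) s := by
    intro s
    have h1 : HasDerivAt (fun s => Real.exp (-κ * s)) (Real.exp (-κ * s) * (-κ)) s := by
      simpa using ((hasDerivAt_id s).const_mul (-κ)).exp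
    exact (h1.mul (hy s).norm_sq).sub (hf2.integral_hasStrictDerivAt 0 s).hasDerivAt
  have hanti : AntitoneOn (fun s => Real.exp (-κ * s) * ‖y s‖ ^ 2 - ∫ r in 0..s, ‖f r‖ ^ 2)
      (Ici 0) := by
    refine antitoneOn_of_deriv_nonpos (convex_Ici 0)
      (fun s _ => (hd s).continuousAt.continuousWithinAt)
      (fun s _ => (hd s).differentiableAt.differentiableWithinAt) fun s hs => ?_
    rw [interior_Ici] at hs
    rw [(hd s).deriv]
    have h1 : inner ℝ (y s) (A (y s) + f s) ≤ β * ‖y s‖ ^ 2 + ‖y s‖ * ‖f s‖ := by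
      rw [inner_add_right, real_inner_comm]
      exact add_le_add (hA _) (real_inner_le_norm _ _)
    have h2 : -κ * ‖y s‖ ^ 2 + 2 * inner ℝ (y s) (A (y s) + f s) ≤ ‖f s‖ ^ 2 := by
      nlinarith [sq_nonneg (‖y s‖ - ‖f s‖)]
    have h3 : Real.exp (-κ * s) ≤ 1 := by
      rw [Real.exp_le_one_iff]
      have : 0 ≤ κ * s := mul_nonneg (by positivity) (le_of_lt hs)
      linarith
    have h4 : Real.exp (-κ * s) * (-κ * ‖y s‖ ^ 2 + 2 * inner ℝ (y s) (A (y s) + f s))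
        ≤ Real.exp (-κ * s) * ‖f s‖ ^ 2 := by gcongr
    have h5 : Real.exp (-κ * s) * ‖f s‖ ^ 2 ≤ ‖f s‖ ^ 2 :=
      mul_le_of_le_one_left (sq_nonneg _) h3
    linarith
  have h := hanti (mem_Ici.2 le_rfl) (mem_Ici.2 ht.1) ht.1
  simp only [mul_zero, Real.exp_zero, one_mul, intervalIntegral.integral_same, sub_zero] at h
  have hmono : ∫ s in 0..t, ‖f s‖ ^ 2 ≤ ∫ s in 0..τ, ‖f s‖ ^ 2 :=
    intervalIntegral.integral_mono_interval le_rfl ht.1 ht.2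
      (Eventually.of_forall fun s => sq_nonneg _) (hf2.intervalIntegrable _ _)
  have h6 : Real.exp (-κ * t) * ‖y t‖ ^ 2 ≤ ‖y 0‖ ^ 2 + ∫ s in 0..τ, ‖f s‖ ^ 2 := by linarith
  have h7 : ‖y t‖ ^ 2 = Real.exp (κ * t) * (Real.exp (-κ * t) * ‖y t‖ ^ 2) := by
    rw [← mul_assoc, ← Real.exp_add]; simp
  rw [h7]
  have hκ0 : 0 ≤ κ := by positivity
  have h8 : 0 ≤ Real.exp (-κ * t) * ‖y t‖ ^ 2 := by positivity
  exact mul_le_mul (Real.exp_le_exp.2 (mul_le_mul_of_nonneg_left ht.2 hκ0)) h6 h8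
    (Real.exp_pos _).le

theorem memLp_timeMeasure_of_continuous {E : Type*} [NormedAddCommGroup E] {f : ℝ → E} (hf : Continuous f) :
    MemLp f 2 (timeMeasure τ) := by
  obtain ⟨C, hC⟩ := (isCompact_Icc (a := (0 : ℝ)) (b := τ)).exists_bound_of_continuousOn
    hf.continuousOn
  refine MemLp.of_bound (hf.continuousOn.aestronglyMeasurable measurableSet_Ioo) C ?_
  filter_upwards [ae_restrict_mem measurableSet_Ioo] with t ht
  exact hC t (Ioo_subset_Icc_self ht)

theorem norm_sq_eq_integral {μ : Measure ℝ} (f : Lp E 2 μ) : ‖f‖ ^ 2 = ∫ t, ‖f t‖ ^ 2 ∂μ := by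
  rw [← real_inner_self_eq_norm_sq, L2.inner_def]
  simp_rw [real_inner_self_eq_norm_sq]

theorem norm_sq_toLp {μ : Measure ℝ} {f : ℝ → E} (hf : MemLp f 2 μ) :
    ‖hf.toLp f‖ ^ 2 = ∫ t, ‖f t‖ ^ 2 ∂μ := by
  rw [norm_sq_eq_integral]
  refine integral_congr_ae ?_
  filter_upwards [hf.coeFn_toLp] with t ht
  rw [ht]

/-- The constant in the a priori estimate for weak solutions. -/
def stabilityConst (β τ : ℝ) : ℝ := Real.sqrt (2 * τ * Real.exp ((2 * β + 1) * τ))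

variable {gen : E → E → Prop} {P A : ℕ → E →L[ℝ] E} {β : ℝ}

/-- Galerkin approximations: weak solutions for continuous right-hand sides and data in the range
of a projection, with the a priori estimate. -/
theorem IsGalerkin.exists_weak_of_continuous [CompleteSpace E] (hG : IsGalerkin gen P A β)
    (hτ : 0 ≤ τ) (N : ℕ) (z₀ : E) {f : ℝ → E} (hf : Continuous f) (hz : P N z₀ = z₀)
    (hPf : ∀ t, P N (f t) = f t) :
    ∃ z : Lp E 2 (timeMeasure τ),
      (z₀, (memLp_timeMeasure_of_continuous hf).toLp f, z) ∈ weakGraph gen hτ ∧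
      ‖z‖ ≤ stabilityConst β τ * ‖(z₀, (memLp_timeMeasure_of_continuous (τ := τ) hf).toLp f)‖ := by
  obtain ⟨y', hy0, hy'⟩ := exists_linear_ode (A N) z₀ hf
  have hcomm : ∀ x, P N (A N x) = A N (P N x) := fun x => hG.proj_eq N _ _ (hG.gen_apply N x)
  -- `P N` commutes with `A N` and fixes the data, so the projected curve solves the same equation.
  -- It stays in the range of `P N`, where `A N` agrees with the unbounded operator.
  set y : ℝ → E := fun t => P N (y' t) with hyd
  have hPy : ∀ t, P N (y t) = y t := fun t => hG.proj_proj N N _ le_rfl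
  have hy : ∀ t, HasDerivAt y (A N (y t) + f t) t := by
    intro t
    have := (P N).hasFDerivAt.comp_hasDerivAt t (hy' t)
    rwa [map_add, hcomm, hPf] at this
  have hyz : y 0 = z₀ := by simp only [hyd, hy0, hz]
  have hyc : Continuous y := continuous_iff_continuousAt.2 fun t => (hy t).continuousAt
  have hm := memLp_timeMeasure_of_continuous (τ := τ) hyc
  have hmf := memLp_timeMeasure_of_continuous (τ := τ) hf
  refine ⟨hm.toLp y, ?_, ?_⟩
  · rw [mem_weakGraph_iff]
    intro h g hhg
    have hd : ∀ t, HasDerivAt (fun t => inner ℝ h (y t)) (inner ℝ g (y t) + inner ℝ h (f t)) t := by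
      intro t
      have h1 := (innerSL ℝ h).hasFDerivAt.comp_hasDerivAt t (hy t)
      have h2 := hhg _ _ (hG.gen_apply N (y t))
      rw [hPy, real_inner_comm, real_inner_comm g] at h2
      rw [← h2, ← inner_add_right]
      exact h1
    have hc : Continuous fun t => inner ℝ g (y t) + inner ℝ h (f t) := by fun_prop
    have hcongr : (fun t => inner ℝ g (hm.toLp y t) + inner ℝ h (hmf.toLp f t))
        =ᵐ[timeMeasure τ] fun t => inner ℝ g (y t) + inner ℝ h (f t) := by
      filter_upwards [hm.coeFn_toLp, hmf.coeFn_toLp] with t h1 h2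
      rw [h1, h2]
    filter_upwards [hm.coeFn_toLp, ae_restrict_mem measurableSet_Ioo] with t h1 ht
    rw [intervalIntegral_congr_timeMeasure hcongr (Ioo_subset_Icc_self ht), h1,
      intervalIntegral.integral_eq_sub_of_hasDerivAt (fun s _ => hd s) (hc.intervalIntegrable _ _),
      hyz]
    ring
  · set d := ‖(z₀, hmf.toLp f)‖ with hdd
    have h1 : ‖z₀‖ ≤ d := norm_fst_le (z₀, hmf.toLp f)
    have h2 : ‖hmf.toLp f‖ ≤ d := norm_snd_le (z₀, hmf.toLp f)
    -- The product carries the sup norm; this is the source of the factor `2` in `stabilityConst`.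
    have h3 : ‖z₀‖ ^ 2 + ∫ s in 0..τ, ‖f s‖ ^ 2 ≤ 2 * d ^ 2 := by
      rw [← integral_timeMeasure hτ, ← norm_sq_toLp hmf]
      have := pow_le_pow_left₀ (norm_nonneg _) h1 2
      have := pow_le_pow_left₀ (norm_nonneg _) h2 2
      linarith
    have h4 : ‖hm.toLp y‖ ^ 2 ≤ τ * (Real.exp ((2 * β + 1) * τ) * (2 * d ^ 2)) := by
      rw [norm_sq_toLp, integral_timeMeasure hτ]
      have : ∫ s in 0..τ, ‖y s‖ ^ 2
          ≤ ∫ s in 0..τ, Real.exp ((2 * β + 1) * τ) * (2 * d ^ 2) := by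
        refine intervalIntegral.integral_mono_on hτ ((hyc.norm.pow 2).intervalIntegrable _ _)
          (continuous_const.intervalIntegrable _ _) fun t ht => ?_
        refine (norm_sq_le_of_ode hG.nonneg (hG.inner_le N) hf hy ht).trans ?_
        rw [hyz]
        gcongr
      refine this.trans (le_of_eq ?_)
      rw [intervalIntegral.integral_const, smul_eq_mul, sub_zero]
    refine abs_le_of_sq_le_sq' ?_ (by unfold stabilityConst; positivity) |>.2
    rw [mul_pow, stabilityConst, Real.sq_sqrt (by positivity)]
    linarith

/-- Uniqueness of weak solutions. -/
theorem IsGalerkin.eq_zero_of_weak [CompleteSpace E] [SecondCountableTopology E]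
    (hG : IsGalerkin gen P A β) (hτ : 0 ≤ τ) {z : Lp E 2 (timeMeasure τ)}
    (hz : (0, 0, z) ∈ weakGraph gen hτ) : z = 0 := by
  rw [mem_weakGraph_iff] at hz
  have key : ∀ N, ∀ᵐ t ∂timeMeasure τ, P N (z t) = 0 := by
    intro N
    have hzi := Lp_integrable z
    set Y : ℝ → E := fun t => ∫ s in 0..t, A N (z s) with hY
    have hAz : Integrable (fun s => A N (z s)) (timeMeasure τ) := (A N).integrable_comp hzi
    have hPY : ∀ᵐ t ∂timeMeasure τ, P N (z t) = Y t := by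
      have : (fun t => P N (z t) - Y t) =ᵐ[timeMeasure τ] 0 := by
        refine ae_eq_zero_of_forall_inner (𝕜 := ℝ) fun h => ?_
        -- Every `(P N)* h` is an admissible test vector because `P N` maps `A x` to `A N x`.
        -- Letting `h` vary turns the weak equation into the vector identity `P N z = ∫ A N z`.
        have hadj : adjRel gen ((P N).adjoint h) ((A N).adjoint h) := by
          intro x y hxy
          rw [ContinuousLinearMap.adjoint_inner_right, ContinuousLinearMap.adjoint_inner_right,
            hG.proj_eq N x y hxy]
        have h0 := Lp.coeFn_zero E 2 (timeMeasure τ)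
        filter_upwards [hz _ _ hadj, ae_restrict_mem measurableSet_Ioo] with t ht ht'
        have e : ∫ s in 0..t, (inner ℝ ((A N).adjoint h) (z s)
              + inner ℝ ((P N).adjoint h) ((0 : Lp E 2 (timeMeasure τ)) s))
            = ∫ s in 0..t, (innerSL ℝ h) (A N (z s)) := by
          refine intervalIntegral_congr_timeMeasure ?_ (Ioo_subset_Icc_self ht')
          filter_upwards [h0] with s hs
          rw [hs, Pi.zero_apply, inner_zero_right, add_zero,
            ContinuousLinearMap.adjoint_inner_left]
          rfl
        rw [e, ContinuousLinearMap.intervalIntegral_comp_comm _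
          (intervalIntegrable_of_timeMeasure' hAz (Ioo_subset_Icc_self ht')),
          ContinuousLinearMap.adjoint_inner_left, inner_zero_right, zero_add] at ht
        rw [Pi.zero_apply, inner_sub_right, ht]
        exact sub_self _
      filter_upwards [this] with t ht
      exact sub_eq_zero.1 ht
    have hYc : ContinuousOn Y (Icc 0 τ) := by
      have := intervalIntegral.continuousOn_primitive_interval (μ := volume) (a := 0) (b := τ)
        (f := fun s => A N (z s)) ?_
      · rwa [uIcc_of_le hτ] at this
      · rw [uIcc_of_le hτ, integrableOn_Icc_iff_integrableOn_Ioo]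
        exact hAz
    -- Since `A N z = A N (P N z)`, the projected equation closes in `Y`, and Grönwall's inequality
    -- will force `Y = 0`.
    have hYY : ∀ t ∈ Icc 0 τ, Y t = ∫ s in 0..t, A N (Y s) := by
      intro t ht
      refine intervalIntegral_congr_timeMeasure ?_ ht
      filter_upwards [hPY] with s hs
      rw [← hs, hG.apply_proj]
    -- Constant extension beyond `[0,τ]` makes the integrand continuous on the whole line, so its
    -- primitive is differentiable everywhere, end points included.
    set Yc : ℝ → E := fun s => Y (projIcc 0 τ hτ s) with hYcd
    have hYcc : Continuous Yc :=
      hYc.comp_continuous (continuous_subtype_val.comp continuous_projIcc)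
        fun s => (projIcc 0 τ hτ s).2
    set W : ℝ → E := fun t => ∫ s in 0..t, A N (Yc s) with hW
    have hWd : ∀ t, HasDerivAt W (A N (Yc t)) t := fun t =>
      (((A N).continuous.comp hYcc).integral_hasStrictDerivAt 0 t).hasDerivAt
    have hYcY : ∀ t ∈ Icc 0 τ, Yc t = Y t := fun t ht => by
      simp only [hYcd, projIcc_of_mem hτ ht]
    have hWY : ∀ t ∈ Icc 0 τ, W t = Y t := by
      intro t ht
      rw [hYY t ht]
      refine intervalIntegral.integral_congr fun s hs => ?_
      rw [uIcc_of_le ht.1] at hs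
      simp only [hYcY s ⟨hs.1, hs.2.trans ht.2⟩]
    have hW0 : ∀ t ∈ Icc 0 τ, W t = 0 := by
      intro t ht
      have := norm_le_gronwallBound_of_norm_deriv_right_le (f := W) (f' := fun t => A N (Yc t))
        (δ := 0) (K := ‖A N‖) (ε := 0) (a := 0) (b := τ)
        (fun s _ => (hWd s).continuousAt.continuousWithinAt)
        (fun s _ => (hWd s).hasDerivWithinAt) (by simp [hW])
        (fun s hs => by
          rw [hYcY s (Ico_subset_Icc_self hs), ← hWY s (Ico_subset_Icc_self hs), add_zero]
          exact (A N).le_opNorm _) t ht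
      rwa [gronwallBound_ε0_δ0, norm_le_zero_iff] at this
    filter_upwards [hPY, ae_restrict_mem measurableSet_Ioo] with t h1 h2
    rw [h1, ← hWY t (Ioo_subset_Icc_self h2), hW0 t (Ioo_subset_Icc_self h2)]
  rw [Lp.eq_zero_iff_ae_eq_zero]
  filter_upwards [ae_all_iff.2 key] with t ht
  refine tendsto_nhds_unique (hG.tendsto_proj (z t)) ?_
  simp only [ht]
  exact tendsto_const_nhds

theorem IsGalerkin.weak_unique [CompleteSpace E] [SecondCountableTopology E]
    (hG : IsGalerkin gen P A β) (hτ : 0 ≤ τ) {z₀ : E} {f z z' : Lp E 2 (timeMeasure τ)}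
    (hz : (z₀, f, z) ∈ weakGraph gen hτ) (hz' : (z₀, f, z') ∈ weakGraph gen hτ) : z = z' := by
  have := (weakGraph gen hτ).sub_mem hz hz'
  simp only [Prod.mk_sub_mk, sub_self] at this
  exact sub_eq_zero.1 (hG.eq_zero_of_weak hτ this)

/-- The function `t ↦ u(t) b`. -/
def smulLp (τ : ℝ) (b : E) : Lp ℝ 2 (timeMeasure τ) →L[ℝ] Lp E 2 (timeMeasure τ) :=
  (ContinuousLinearMap.toSpanSingleton ℝ b).compLpL 2 (timeMeasure τ)

theorem coeFn_smulLp (b : E) (u : Lp ℝ 2 (timeMeasure τ)) :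
    smulLp τ b u =ᵐ[timeMeasure τ] fun t => u t • b :=
  (ContinuousLinearMap.toSpanSingleton ℝ b).coeFn_compLpL u

theorem norm_smulLp (b : E) (u : Lp ℝ 2 (timeMeasure τ)) : ‖smulLp τ b u‖ = ‖b‖ * ‖u‖ := by
  rw [← sq_eq_sq₀ (norm_nonneg _) (by positivity), mul_pow, norm_sq_eq_integral,
    norm_sq_eq_integral, ← integral_const_mul]
  refine integral_congr_ae ?_
  filter_upwards [coeFn_smulLp b u] with t ht
  rw [ht, norm_smul]; ring

theorem smulLp_sub (b b' : E) (u : Lp ℝ 2 (timeMeasure τ)) :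
    smulLp τ (b - b') u = smulLp τ b u - smulLp τ b' u := by
  rw [Lp.ext_iff]
  filter_upwards [coeFn_smulLp b u, coeFn_smulLp b' u, coeFn_smulLp (b - b') u,
    Lp.coeFn_sub (smulLp τ b u) (smulLp τ b' u)] with t h1 h2 h3 h4
  rw [h4, Pi.sub_apply, h1, h2, h3, smul_sub]

/-- Existence of weak solutions, with the a priori estimate. -/
theorem IsGalerkin.exists_weak [CompleteSpace E] [SecondCountableTopology E]
    (hG : IsGalerkin gen P A β) (hτ : 0 ≤ τ) (z₀ b : E) (u : Lp ℝ 2 (timeMeasure τ)) :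
    ∃ z : Lp E 2 (timeMeasure τ), (z₀, smulLp τ b u, z) ∈ weakGraph gen hτ ∧
      ‖z‖ ≤ stabilityConst β τ * ‖(z₀, smulLp τ b u)‖ := by
  have hdense : ∀ k : ℕ, ∃ v : BoundedContinuousFunction ℝ ℝ,
      ‖u - (memLp_timeMeasure_of_continuous v.continuous).toLp v‖ < 1 / ((k : ℝ) + 1) := by
    intro k
    obtain ⟨v, hv⟩ := (BoundedContinuousFunction.toLp_denseRange ℝ (timeMeasure τ) (p := 2) ℝ
      (by norm_num)).exists_dist_lt u (ε := 1 / ((k : ℝ) + 1)) (by positivity)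
    refine ⟨v, ?_⟩
    rw [dist_eq_norm] at hv
    exact hv
  choose v hv using hdense
  have hvm : ∀ k, MemLp (v k) 2 (timeMeasure τ) := fun k =>
    memLp_timeMeasure_of_continuous (v k).continuous
  set w : ℕ → Lp ℝ 2 (timeMeasure τ) := fun k => (hvm k).toLp (v k) with hw
  have hwu : Tendsto w atTop (𝓝 u) := by
    rw [tendsto_iff_norm_sub_tendsto_zero]
    refine squeeze_zero (fun _ => norm_nonneg _) (fun k => ?_) tendsto_one_div_add_atTop_nhds_zero_nat
    rw [norm_sub_rev]
    exact (hv k).le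
  set d : ℕ → E × Lp E 2 (timeMeasure τ) := fun k => (P k z₀, smulLp τ (P k b) (w k)) with hd
  have hdlim : Tendsto d atTop (𝓝 (z₀, smulLp τ b u)) := by
    refine (hG.tendsto_proj z₀).prodMk_nhds ?_
    rw [tendsto_iff_norm_sub_tendsto_zero]
    have hb : Tendsto (fun k => ‖P k b - b‖ * ‖w k‖ + ‖b‖ * ‖w k - u‖) atTop (𝓝 (0 * ‖u‖ + ‖b‖ * 0)) :=
      ((tendsto_iff_norm_sub_tendsto_zero.1 (hG.tendsto_proj b)).mul hwu.norm).add
        ((tendsto_iff_norm_sub_tendsto_zero.1 hwu).const_mul _)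
    rw [zero_mul, mul_zero, add_zero] at hb
    refine squeeze_zero (fun _ => norm_nonneg _) (fun k => ?_) hb
    rw [← norm_smulLp, ← norm_smulLp, smulLp_sub, map_sub]
    refine le_trans (le_of_eq ?_) (norm_add_le _ _)
    congr 1
    abel
  -- weak solutions for differences of the approximate data
  have hsol : ∀ k l : ℕ, ∀ a c : ℝ, ∃ z, (a • d k - c • d l, z) ∈
      ((weakGraph gen hτ).comap (LinearEquiv.prodAssoc ℝ E _ _).toLinearMap) ∧
      ‖z‖ ≤ stabilityConst β τ * ‖a • d k - c • d l‖ := by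
    intro k l a c
    -- At level `max k l` both data lie in the range of one projection. The scalars `(1, 0)` later
    -- give the approximate solutions and `(1, 1)` their differences.
    set N := max k l
    have hf : Continuous fun t => a • (v k t • P k b) - c • (v l t • P l b) := by fun_prop
    have hPk : ∀ x, P N (P k x) = P k x := fun x => hG.proj_proj _ _ _ (le_max_left _ _)
    have hPl : ∀ x, P N (P l x) = P l x := fun x => hG.proj_proj _ _ _ (le_max_right _ _)
    obtain ⟨z, hz1, hz2⟩ := hG.exists_weak_of_continuous hτ N (a • P k z₀ - c • P l z₀) hf
      (by rw [map_sub, map_smul, map_smul, hPk, hPl])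
      (fun t => by rw [map_sub, map_smul, map_smul, map_smul, map_smul, hPk, hPl])
    have e : (memLp_timeMeasure_of_continuous (τ := τ) hf).toLp _
        = a • smulLp τ (P k b) (w k) - c • smulLp τ (P l b) (w l) := by
      rw [Lp.ext_iff]
      filter_upwards [(memLp_timeMeasure_of_continuous (τ := τ) hf).coeFn_toLp,
        coeFn_smulLp (P k b) (w k), coeFn_smulLp (P l b) (w l),
        Lp.coeFn_sub (a • smulLp τ (P k b) (w k)) (c • smulLp τ (P l b) (w l)),
        Lp.coeFn_smul a (smulLp τ (P k b) (w k)), Lp.coeFn_smul c (smulLp τ (P l b) (w l)),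
        (hvm k).coeFn_toLp, (hvm l).coeFn_toLp] with t h1 h2 h3 h4 h5 h6 h7 h8
      rw [h1, h4, Pi.sub_apply, h5, h6, Pi.smul_apply, Pi.smul_apply, h2, h3, h7, h8]
    rw [e] at hz1 hz2
    exact ⟨z, hz1, hz2⟩
  have hsol1 : ∀ k, ∃ z, ((d k).1, (d k).2, z) ∈ weakGraph gen hτ ∧
      ‖z‖ ≤ stabilityConst β τ * ‖d k‖ := by
    intro k
    obtain ⟨z, h1, h2⟩ := hsol k k 1 0
    rw [one_smul, zero_smul, sub_zero] at h1 h2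
    exact ⟨z, h1, h2⟩
  choose z hz1 hz2 using hsol1
  -- The a priori bound is attached to constructed solutions only; uniqueness identifies the one
  -- constructed for `d k - d l` with `z k - z l`.
  have hdiff : ∀ k l, ‖z k - z l‖ ≤ stabilityConst β τ * ‖d k - d l‖ := by
    intro k l
    obtain ⟨y, h1, h2⟩ := hsol k l 1 1
    rw [one_smul, one_smul] at h1 h2
    have h3 := (weakGraph gen hτ).sub_mem (hz1 k) (hz1 l)
    rwa [← hG.weak_unique hτ h1 h3]
  have hcauchy : CauchySeq z := by
    have hdc := hdlim.cauchySeq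
    rw [Metric.cauchySeq_iff] at hdc ⊢
    intro ε hε
    have hC : 0 ≤ stabilityConst β τ := Real.sqrt_nonneg _
    obtain ⟨n, hn⟩ := hdc (ε / (stabilityConst β τ + 1)) (by positivity)
    refine ⟨n, fun k hk l hl => ?_⟩
    have h := hn k hk l hl
    rw [dist_eq_norm] at h ⊢
    rw [lt_div_iff₀ (by positivity)] at h
    have := hdiff k l
    nlinarith [norm_nonneg (d k - d l)]
  obtain ⟨y, hy⟩ := cauchySeq_tendsto_of_complete hcauchy
  refine ⟨y, ?_, ?_⟩
  · have hlim : Tendsto (fun k => ((d k).1, (d k).2, z k)) atTop (𝓝 (z₀, smulLp τ b u, y)) := by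
      rw [nhds_prod_eq] at hdlim
      exact hdlim.fst.prodMk_nhds (hdlim.snd.prodMk_nhds hy)
    exact (isClosed_weakGraph gen hτ).mem_of_tendsto hlim (Eventually.of_forall hz1)
  · exact le_of_tendsto_of_tendsto hy.norm (hdlim.norm.const_mul _) (Eventually.of_forall hz2)

end Galerkin

/-! ### Linear-quadratic optimal control -/

section Optimal

/-- A weighted sum of squared norms attains its minimum on a closed convex set. -/
theorem exists_min_weighted_norm_sq {U Z : Type*} [NormedAddCommGroup U] [InnerProductSpace ℝ U]
    [CompleteSpace U] [NormedAddCommGroup Z] [InnerProductSpace ℝ Z] [CompleteSpace Z]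
    {S : Set (U × Z)} (hne : S.Nonempty) (hcl : IsClosed S) (hconv : Convex ℝ S) {γ : ℝ}
    (hγ : 0 < γ) :
    ∃ p ∈ S, ∀ q ∈ S, ‖p.2‖ ^ 2 + γ * ‖p.1‖ ^ 2 ≤ ‖q.2‖ ^ 2 + γ * ‖q.1‖ ^ 2 := by
  have hs : 0 < √γ := Real.sqrt_pos.2 hγ
  -- Rescaling the first factor by `√γ` turns the weighted sum into a squared Hilbert norm, so the
  -- minimiser is the projection of `0` onto a closed convex set.
  let L : WithLp 2 (U × Z) →L[ℝ] U × Z :=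
    (((√γ)⁻¹ • ContinuousLinearMap.id ℝ U).prodMap (.id ℝ Z))
      ∘L (WithLp.prodContinuousLinearEquiv 2 ℝ U Z).toContinuousLinearMap
  have hL : ∀ x, L x = ((√γ)⁻¹ • x.fst, x.snd) := fun x => rfl
  have hLinv : ∀ q : U × Z, L (WithLp.toLp 2 (√γ • q.1, q.2)) = q := by
    intro q
    refine Prod.ext ?_ rfl
    change (√γ)⁻¹ • √γ • q.1 = q.1
    rw [smul_smul, inv_mul_cancel₀ hs.ne', one_smul]
  have hnorm : ∀ x, ‖x‖ ^ 2 = ‖(L x).2‖ ^ 2 + γ * ‖(L x).1‖ ^ 2 := by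
    intro x
    rw [WithLp.prod_norm_sq_eq_of_L2, hL, norm_smul, mul_pow, norm_inv, Real.norm_of_nonneg hs.le,
      inv_pow, Real.sq_sqrt hγ.le, mul_inv_cancel_left₀ hγ.ne', add_comm]
  obtain ⟨q₀, hq₀⟩ := hne
  obtain ⟨v, hv, hmin⟩ := exists_norm_eq_iInf_of_complete_convex (K := L ⁻¹' S)
    ⟨WithLp.toLp 2 (√γ • q₀.1, q₀.2), by rwa [mem_preimage, hLinv]⟩
    (hcl.preimage L.continuous).isComplete (hconv.linear_preimage L.toLinearMap) 0
  refine ⟨L v, hv, fun q hq => ?_⟩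
  have hle : ‖(0 : WithLp 2 (U × Z)) - v‖ ≤ ‖(0 : WithLp 2 (U × Z))
      - WithLp.toLp 2 (√γ • q.1, q.2)‖ := by
    rw [hmin]
    exact ciInf_le ⟨0, by rintro _ ⟨w, rfl⟩; exact norm_nonneg _⟩
      (⟨WithLp.toLp 2 (√γ • q.1, q.2), by rwa [mem_preimage, hLinv]⟩ : L ⁻¹' S)
  rw [zero_sub, zero_sub, norm_neg, norm_neg] at hle
  have := pow_le_pow_left₀ (norm_nonneg _) hle 2
  rwa [hnorm, hnorm, hLinv] at this

variable {τ : ℝ} {E : Type*} [NormedAddCommGroup E] [InnerProductSpace ℝ E]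
  {gen : E → E → Prop} {P A : ℕ → E →L[ℝ] E} {β : ℝ}

/-- The costs of all controls for the input vector `b` and the initial state `z₀`. -/
def lqCosts (gen : E → E → Prop) (hτ : 0 ≤ τ) (γ : ℝ) (z₀ b : E) : Set ℝ :=
  {j | ∃ (u : Lp ℝ 2 (timeMeasure τ)) (z : Lp E 2 (timeMeasure τ)),
    (z₀, smulLp τ b u, z) ∈ weakGraph gen hτ ∧ j = ‖z‖ ^ 2 + γ * ‖u‖ ^ 2}

theorem lqCosts_bddBelow (gen : E → E → Prop) (hτ : 0 ≤ τ) {γ : ℝ} (hγ : 0 < γ) (z₀ b : E) :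
    BddBelow (lqCosts gen hτ γ z₀ b) := by
  refine ⟨0, ?_⟩
  rintro _ ⟨u, z, -, rfl⟩
  positivity

/-- The optimal cost is attained. -/
theorem IsGalerkin.isLeast_lqCosts [CompleteSpace E] [SecondCountableTopology E]
    (hG : IsGalerkin gen P A β) (hτ : 0 ≤ τ) {γ : ℝ} (hγ : 0 < γ) (z₀ b : E) :
    IsLeast (lqCosts gen hτ γ z₀ b) (sInf (lqCosts gen hτ γ z₀ b)) := by
  -- Minimising jointly over `(u, z)` avoids a solution operator: this set is a closed affine slice
  -- of the weak graph.
  let S : Set (Lp ℝ 2 (timeMeasure τ) × Lp E 2 (timeMeasure τ)) :=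
    {p | (z₀, smulLp τ b p.1, p.2) ∈ weakGraph gen hτ}
  have hne : S.Nonempty := by
    obtain ⟨z, hz, -⟩ := hG.exists_weak hτ z₀ b 0
    exact ⟨(0, z), hz⟩
  have hcl : IsClosed S := (isClosed_weakGraph gen hτ).preimage (by fun_prop)
  have hconv : Convex ℝ S := by
    intro p hp q hq s t _ _ hst
    have := (weakGraph gen hτ).add_mem ((weakGraph gen hτ).smul_mem s hp)
      ((weakGraph gen hτ).smul_mem t hq)
    simp only [Prod.smul_mk, Prod.mk_add_mk, ← add_smul, hst, one_smul, ← map_smul,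
      ← map_add] at this
    exact this
  obtain ⟨p, hp, hmin⟩ := exists_min_weighted_norm_sq hne hcl hconv hγ
  have hmem : ‖p.2‖ ^ 2 + γ * ‖p.1‖ ^ 2 ∈ lqCosts gen hτ γ z₀ b := ⟨p.1, p.2, hp, rfl⟩
  have hleast : IsLeast (lqCosts gen hτ γ z₀ b) (‖p.2‖ ^ 2 + γ * ‖p.1‖ ^ 2) := by
    refine ⟨hmem, ?_⟩
    rintro _ ⟨u, z, hz, rfl⟩
    exact hmin (u, z) hz
  rwa [hleast.csInf_eq]

/-- The triangle inequality in the plane for `(y, √c)` shifted by `d` in the first coordinate. It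
lets a perturbation of the trajectory enter the root of the cost linearly. -/
theorem sqrt_sq_add_le {x y c d : ℝ} (hx : 0 ≤ x) (hy : 0 ≤ y) (hc : 0 ≤ c) (hd : 0 ≤ d)
    (h : x ≤ y + d) : √(x ^ 2 + c) ≤ √(y ^ 2 + c) + d := by
  rw [Real.sqrt_le_left (by positivity)]
  have h1 : y ≤ √(y ^ 2 + c) := Real.le_sqrt_of_sq_le (by linarith)
  have h2 : √(y ^ 2 + c) ^ 2 = y ^ 2 + c := Real.sq_sqrt (by positivity)
  nlinarith [mul_le_mul_of_nonneg_right h1 hd]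

/-- The square root of the optimal cost is Lipschitz continuous in the input vector. -/
theorem IsGalerkin.exists_sqrt_lqCosts_le [CompleteSpace E] [SecondCountableTopology E]
    (hG : IsGalerkin gen P A β) (hτ : 0 ≤ τ) {γ : ℝ} (hγ : 0 < γ) (z₀ : E) :
    ∃ K : NNReal, LipschitzWith K fun b => √(sInf (lqCosts gen hτ γ z₀ b)) := by
  obtain ⟨y, hy, -⟩ := hG.exists_weak hτ z₀ 0 0
  set C := stabilityConst β τ with hC
  have hC0 : 0 ≤ C := Real.sqrt_nonneg _
  -- The optimal control for `b'` is tried with `b`. The constant is the stability constant times a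
  -- bound on that control which does not depend on `b'`.
  refine ⟨⟨C * (‖y‖ / √γ), by positivity⟩, LipschitzWith.of_le_add_mul _ fun b b' => ?_⟩
  obtain ⟨⟨u, z', hz', hJ'⟩, hmin'⟩ := hG.isLeast_lqCosts hτ hγ z₀ b'
  obtain ⟨z, hz, -⟩ := hG.exists_weak hτ z₀ b u
  have hJ : sInf (lqCosts gen hτ γ z₀ b) ≤ ‖z‖ ^ 2 + γ * ‖u‖ ^ 2 :=
    csInf_le (lqCosts_bddBelow gen hτ hγ z₀ b) ⟨u, z, hz, rfl⟩
  -- Comparison with zero control, whose trajectory `y` is the same for every input vector.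
  have hu : γ * ‖u‖ ^ 2 ≤ ‖y‖ ^ 2 := by
    have : ‖z'‖ ^ 2 + γ * ‖u‖ ^ 2 ≤ ‖y‖ ^ 2 + γ * ‖(0 : Lp ℝ 2 (timeMeasure τ))‖ ^ 2 := by
      rw [← hJ']
      refine hmin' ⟨0, y, ?_, rfl⟩
      rwa [map_zero] at hy ⊢
    rw [norm_zero] at this
    nlinarith [sq_nonneg ‖z'‖]
  have hu' : ‖u‖ ≤ ‖y‖ / √γ := by
    rw [le_div_iff₀ (Real.sqrt_pos.2 hγ)]
    refine abs_le_of_sq_le_sq' ?_ (norm_nonneg _) |>.2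
    rw [mul_pow, Real.sq_sqrt hγ.le]
    linarith
  have hdiff : ‖z - z'‖ ≤ C * (‖y‖ / √γ) * ‖b - b'‖ := by
    have h1 := (weakGraph gen hτ).sub_mem hz hz'
    simp only [Prod.mk_sub_mk, sub_self, ← smulLp_sub] at h1
    obtain ⟨x, hx, hxn⟩ := hG.exists_weak hτ 0 (b - b') u
    rw [hG.weak_unique hτ h1 hx]
    refine hxn.trans ?_
    rw [Prod.norm_mk, norm_zero, max_eq_right (norm_nonneg _), norm_smulLp, mul_assoc]
    rw [mul_comm ‖b - b'‖]
    gcongr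
  rw [hJ', dist_eq_norm]
  refine (Real.sqrt_le_sqrt hJ).trans ?_
  refine sqrt_sq_add_le (norm_nonneg _) (norm_nonneg _) (by positivity)
    (mul_nonneg (NNReal.coe_nonneg _) (norm_nonneg _)) ?_
  have h2 : ‖z‖ ≤ ‖z'‖ + ‖z - z'‖ := by
    have := norm_add_le z' (z - z')
    rwa [add_sub_cancel] at this
  exact h2.trans (by gcongr; exact hdiff)

end Optimal

/-! ### The beam as an abstract evolution equation -/

section Bridge

variable {Cd mu τ : ℝ}

theorem Lp_integrable_inner (h : H) (f : Lp H 2 (timeMeasure τ)) :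
    Integrable (fun t => inner ℝ h (f t)) (timeMeasure τ) :=
  (innerSL ℝ h).integrable_comp (Lp_integrable f)

/-- The fundamental theorem of calculus for absolutely continuous functions: the representative `F`
is recovered from its derivative, and conversely the integrated equation supplies a primitive that
serves as `F`. -/
theorem isWeakSolution_iff (hτ : 0 ≤ τ) {r : K} {u : Lp ℝ 2 (timeMeasure τ)} {z₀ : H}
    {z : Lp H 2 (timeMeasure τ)} :
    IsWeakSolution Cd mu τ r u z₀ z ↔
      (z₀, smulLp τ (inputState r) u, z) ∈ weakGraph (IsGenerator Cd mu) hτ := by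
  rw [mem_weakGraph_iff]
  refine forall_congr' fun h => forall_congr' fun g => imp_congr Iff.rfl ?_
  have hint : Integrable (fun t => inner ℝ g (z t) + inner ℝ h (smulLp τ (inputState r) u t))
      (timeMeasure τ) := (Lp_integrable_inner g z).add (Lp_integrable_inner h _)
  have hcongr : ∀ᵐ t ∂timeMeasure τ, inner ℝ g (z t) + inner ℝ h (inputOp r (u t))
      = inner ℝ g (z t) + inner ℝ h (smulLp τ (inputState r) u t) := by
    filter_upwards [coeFn_smulLp (inputState r) u] with t ht
    rw [ht]; rfl
  constructor
  · rintro ⟨F, hF, hFz, hFd, hF0⟩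
    have hd : deriv F =ᵐ[timeMeasure τ]
        fun t => inner ℝ g (z t) + inner ℝ h (smulLp τ (inputState r) u t) := by
      filter_upwards [hFd, hcongr] with t h1 h2
      rw [h1.deriv, h2]
    filter_upwards [hFz, ae_restrict_mem measurableSet_Ioo] with t h1 ht
    have ht' := Ioo_subset_Icc_self ht
    have hFt : AbsolutelyContinuousOnInterval F 0 t := hF.mono (by
      rw [uIcc_of_le ht'.1, uIcc_of_le hτ]
      exact Icc_subset_Icc_right ht'.2)
    rw [← h1, ← hF0, ← intervalIntegral_congr_timeMeasure hd ht', hFt.integral_deriv_eq_sub]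
    ring
  · intro hz
    have hconst : AbsolutelyContinuousOnInterval (fun _ : ℝ => inner ℝ h z₀) 0 τ :=
      (LipschitzWith.const _).lipschitzOnWith.absolutelyContinuousOnInterval
    refine ⟨_, hconst.add (absolutelyContinuous_primitive hτ hint), ?_, ?_, ?_⟩
    · filter_upwards [hz] with t ht
      rw [ht]; rfl
    · filter_upwards [hasDerivAt_primitive hτ hint, hcongr] with t h1 h2
      rw [h2]
      exact h1.const_add _
    · simp

theorem cost_eq (γ : ℝ) (u : Lp ℝ 2 (timeMeasure τ)) (z : Lp H 2 (timeMeasure τ)) :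
    cost γ τ u z = ‖z‖ ^ 2 + γ * ‖u‖ ^ 2 := by
  have hz := (Lp.memLp z).integrable_norm_pow two_ne_zero
  have hu := (Lp.memLp u).integrable_norm_pow two_ne_zero
  simp only [cost, ← Real.norm_eq_abs]
  rw [norm_sq_eq_integral, norm_sq_eq_integral, integral_add hz (hu.const_mul γ),
    integral_const_mul]

theorem costValues_eq (hτ : 0 ≤ τ) (γ : ℝ) (z₀ : H) (r : K) :
    costValues Cd mu τ γ z₀ r = lqCosts (IsGenerator Cd mu) hτ γ z₀ (inputState r) := by
  simp only [costValues, lqCosts, isWeakSolution_iff hτ, cost_eq]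

end Bridge

/-! ### Admissible actuator shapes -/

section Shapes

theorem unitMeasure_eq_restrict_Icc : unitMeasure = volume.restrict (Icc 0 1) :=
  Measure.restrict_congr_set Ioo_ae_eq_Icc

/-- The class of an indicator function in `L^∞(0,1)`. -/
def shape {S : Set ℝ} (hS : MeasurableSet S) : K :=
  (memLp_indicator_const (μ := unitMeasure) ∞ hS (1 : ℝ) (Or.inr (measure_ne_top _ _))).toLp _

theorem fn_shape {S : Set ℝ} (hS : MeasurableSet S) :
    (shape hS).fn =ᵐ[unitMeasure] S.indicator (fun _ => (1 : ℝ)) :=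
  (memLp_indicator_const (μ := unitMeasure) ∞ hS (1 : ℝ)
    (Or.inr (measure_ne_top _ _))).coeFn_toLp

theorem integral_indicator_unitMeasure {S : Set ℝ} (hS : MeasurableSet S) (hS1 : S ⊆ Icc 0 1)
    {c : ℝ} (hc : 0 ≤ c) (hv : volume S = ENNReal.ofReal c) :
    ∫ x, S.indicator (fun _ => (1 : ℝ)) x ∂unitMeasure = c := by
  rw [integral_indicator hS, setIntegral_const, smul_eq_mul, mul_one, unitMeasure_eq_restrict_Icc,
    Measure.real, Measure.restrict_apply hS, inter_eq_left.2 hS1, hv, ENNReal.toReal_ofReal hc]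

theorem Kad.integral_fn {V c : ℝ} (hc : 0 ≤ c) {r : K} (hr : r ∈ Kad V c) :
    ∫ x, r.fn x ∂unitMeasure = c := by
  obtain ⟨S, hS, hS1, hrS, -, hv⟩ := hr
  rw [integral_congr_ae hrS, integral_indicator_unitMeasure hS hS1 hc hv]

theorem Kad.fn_mul_self {V c : ℝ} {r : K} (hr : r ∈ Kad V c) :
    ∀ᵐ x ∂unitMeasure, r.fn x * r.fn x = r.fn x := by
  obtain ⟨S, -, -, hrS, -⟩ := hr
  filter_upwards [hrS] with x hx
  rw [hx]
  by_cases h : x ∈ S <;> simp [h]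

theorem K.memLp_two (r : K) : MemLp r.fn 2 unitMeasure := r.memLp.mono_exponent le_top

theorem K.integrable (r : K) : Integrable r.fn unitMeasure := r.memLp.integrable le_top

theorem K.integrable_mul (r s : K) : Integrable (fun x => r.fn x * s.fn x) unitMeasure :=
  r.memLp_two.integrable_mul s.memLp_two

theorem norm_inputState_sub (r₁ r₂ : K) :
    ‖inputState r₂ - inputState r₁‖ = √(∫ x, (r₂.fn x - r₁.fn x) ^ 2 ∂unitMeasure) := by
  have h : ‖inputState r₂ - inputState r₁‖ ^ 2
      = ‖r₂.memLp_two.toLp r₂.fn - r₁.memLp_two.toLp r₁.fn‖ ^ 2 := by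
    have e : ‖inputState r₂ - inputState r₁‖ = ‖(inputState r₂).1 - (inputState r₁).1‖ := rfl
    rw [e, PiLp.norm_sq_eq_of_L2, Fin.sum_univ_three]
    simp [inputState]
  rw [← MemLp.toLp_sub, norm_sq_toLp] at h
  rw [← Real.sqrt_sq (norm_nonneg (inputState r₂ - inputState r₁)), h]
  simp

theorem inputOp_sub (r₁ r₂ : K) : inputOp r₂ - inputOp r₁
    = ContinuousLinearMap.toSpanSingleton ℝ (inputState r₂ - inputState r₁) := by
  ext; simp [inputOp]

theorem norm_inputOp_sub (r₁ r₂ : K) :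
    ‖inputOp r₂ - inputOp r₁‖ = ‖inputState r₂ - inputState r₁‖ := by
  rw [inputOp_sub, ContinuousLinearMap.norm_toSpanSingleton]

theorem K.continuous_integral_mul {f : ℝ → ℝ} (hf : Integrable f unitMeasure) :
    Continuous fun r : K => ∫ x, r.fn x * f x ∂unitMeasure := by
  have h : Continuous fun r : K => ∫ x, r.fn x * (hf.toL1 f) x ∂unitMeasure :=
    (continuous_apply (A := fun _ : Lp ℝ 1 unitMeasure => ℝ) (hf.toL1 f)).comp
      (continuous_induced_dom (f := fun (r : K) (g : Lp ℝ 1 unitMeasure) =>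
        ∫ x, r.fn x * g x ∂unitMeasure))
  refine h.congr fun r => integral_congr_ae ?_
  filter_upwards [hf.coeFn_toL1] with x hx
  rw [hx]

/-- Idempotence and equal integrals remove the quadratic terms. What is left is affine in `r`, hence
weak-* continuous. -/
theorem Kad.integral_sub_sq {V c : ℝ} (hc : 0 ≤ c) {r s : K} (hr : r ∈ Kad V c)
    (hs : s ∈ Kad V c) : ∫ x, (r.fn x - s.fn x) ^ 2 ∂unitMeasure
      = 2 * (c - ∫ x, r.fn x * s.fn x ∂unitMeasure) := by
  have e : ∫ x, (r.fn x - s.fn x) ^ 2 ∂unitMeasure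
      = ∫ x, ((r.fn + s.fn) x - 2 * (r.fn x * s.fn x)) ∂unitMeasure := by
    refine integral_congr_ae ?_
    filter_upwards [Kad.fn_mul_self hr, Kad.fn_mul_self hs] with x h1 h2
    rw [Pi.add_apply]
    linear_combination h1 + h2
  rw [e, integral_sub (r.integrable.add s.integrable) ((r.integrable_mul s).const_mul 2),
    integral_add' r.integrable s.integrable, integral_const_mul, Kad.integral_fn hc hr,
    Kad.integral_fn hc hs]
  ring

/-- On the admissible set the weak-* topology controls the `L²` distance. -/
theorem Kad.tendsto_norm_sub {V c : ℝ} (hc : 0 ≤ c) {s : K} (hs : s ∈ Kad V c) :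
    Tendsto (fun r => ‖inputState r - inputState s‖) (𝓝[Kad V c] s) (𝓝 0) := by
  have h1 : Tendsto (fun r : K => √(2 * (c - ∫ x, r.fn x * s.fn x ∂unitMeasure))) (𝓝[Kad V c] s)
      (𝓝 √(2 * (c - ∫ x, s.fn x * s.fn x ∂unitMeasure))) := by
    refine Tendsto.mono_left (Continuous.tendsto ?_ s) nhdsWithin_le_nhds
    have := K.continuous_integral_mul s.integrable
    fun_prop
  have h2 : ∫ x, s.fn x * s.fn x ∂unitMeasure = c := by
    rw [integral_congr_ae (Kad.fn_mul_self hs), Kad.integral_fn hc hs]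
  rw [h2, sub_self, mul_zero, Real.sqrt_zero] at h1
  refine h1.congr' ?_
  filter_upwards [self_mem_nhdsWithin] with r hr
  rw [norm_inputState_sub, Kad.integral_sub_sq hc hr hs]

theorem Kad.continuousOn_inputState {V c : ℝ} (hc : 0 ≤ c) :
    ContinuousOn inputState (Kad V c) := fun _ hs =>
  tendsto_iff_norm_sub_tendsto_zero.2 (Kad.tendsto_norm_sub hc hs)

theorem Kad.continuousOn_inputOp {V c : ℝ} (hc : 0 ≤ c) : ContinuousOn inputOp (Kad V c) :=
  fun s hs => (tendsto_iff_norm_sub_tendsto_zero (f := inputOp) (b := inputOp s)).2 (by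
    simpa only [norm_inputOp_sub] using Kad.tendsto_norm_sub hc hs)

/-! ### Compactness of the admissible set -/

theorem one_le_eVariationOn_indicator {S I : Set ℝ} {x y : ℝ} (hx : x ∈ I) (hy : y ∈ I)
    (hxS : x ∈ S) (hyS : y ∉ S) :
    1 ≤ eVariationOn (S.indicator (fun _ => (1 : ℝ))) I := by
  have := eVariationOn.edist_le (S.indicator (fun _ => (1 : ℝ))) hx hy
  simpa [hxS, hyS, edist_dist] using this

/-- Two sets of bounded variation that agree on a grid differ by a set of small measure. -/
theorem volume_symmDiff_le {S T : Set ℝ} (hS : S ⊆ Icc 0 1) (hT : T ⊆ Icc 0 1) {W : ℝ≥0∞}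
    (hSW : eVariationOn (S.indicator (fun _ => (1 : ℝ))) (Icc 0 1) ≤ W)
    (hTW : eVariationOn (T.indicator (fun _ => (1 : ℝ))) (Icc 0 1) ≤ W)
    {n : ℕ} (hn : 0 < n) (h : ∀ k < n, ((k : ℝ) / n ∈ S ↔ (k : ℝ) / n ∈ T)) :
    volume (symmDiff S T) ≤ 2 * W / n := by
  have hn0 : (0 : ℝ) < n := by exact_mod_cast hn
  set I : ℕ → Set ℝ := fun k => Icc ((k : ℝ) / n) (((k + 1 : ℕ) : ℝ) / n) with hI
  have hmono : Monotone fun k : ℕ => (k : ℝ) / n := fun a b hab => by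
    have : (a : ℝ) ≤ b := by exact_mod_cast hab
    exact div_le_div_of_nonneg_right this hn0.le
  have hsum : ∀ f : ℝ → ℝ, ∑ k ∈ Finset.range n, eVariationOn f (I k)
      = eVariationOn f (Icc 0 1) := by
    intro f
    rw [eVariationOn.sum' f hmono]
    simp [hn0.ne']
  have hcover : symmDiff S T ⊆ ⋃ k ∈ Finset.range n, (symmDiff S T ∩ I k) := by
    intro x hx
    have hx1 : x ∈ Icc (0 : ℝ) 1 := hx.elim (fun h => hS h.1) fun h => hT h.1
    rw [mem_iUnion₂]
    -- The point `1` is put in the last cell by hand, since `⌊1 * n⌋₊ = n` lies outside the range.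
    rcases eq_or_lt_of_le hx1.2 with rfl | hlt
    · refine ⟨n - 1, Finset.mem_range.2 (by omega), hx, ?_, ?_⟩
      · rw [div_le_one hn0]; exact_mod_cast Nat.sub_le n 1
      · rw [Nat.sub_add_cancel hn, div_self hn0.ne']
    · have hxn : 0 ≤ x * n := mul_nonneg hx1.1 hn0.le
      refine ⟨⌊x * n⌋₊, Finset.mem_range.2 ?_, hx, ?_, ?_⟩
      · rw [Nat.floor_lt hxn]
        nlinarith
      · rw [div_le_iff₀ hn0]
        exact Nat.floor_le hxn
      · rw [le_div_iff₀ hn0]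
        push_cast
        exact (Nat.lt_floor_add_one _).le
  -- A cell that meets the symmetric difference has agreement at its left end point and disagreement
  -- at some `x`, so one of the two indicators jumps inside it. Each such cell, of length `1/n`,
  -- costs at least one unit of variation.
  have hpiece : ∀ k ∈ Finset.range n, volume (symmDiff S T ∩ I k)
      ≤ (eVariationOn (S.indicator (fun _ => (1 : ℝ))) (I k)
        + eVariationOn (T.indicator (fun _ => (1 : ℝ))) (I k)) / n := by
    intro k hk
    rcases (symmDiff S T ∩ I k).eq_empty_or_nonempty with he | ⟨x, hx, hxI⟩
    · simp [he]
    · have hkI : (k : ℝ) / n ∈ I k := ⟨le_rfl, hmono (Nat.le_succ k)⟩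
      have hgrid := h k (Finset.mem_range.1 hk)
      have hvar : 1 ≤ eVariationOn (S.indicator (fun _ => (1 : ℝ))) (I k)
          + eVariationOn (T.indicator (fun _ => (1 : ℝ))) (I k) := by
        rcases hx with ⟨h1, h2⟩ | ⟨h1, h2⟩ <;> by_cases hkS : (k : ℝ) / n ∈ S
        · exact (one_le_eVariationOn_indicator hkI hxI (hgrid.1 hkS) h2).trans le_add_self
        · exact (one_le_eVariationOn_indicator hxI hkI h1 hkS).trans le_self_add
        · exact (one_le_eVariationOn_indicator hkI hxI hkS h2).trans le_self_add
        · exact (one_le_eVariationOn_indicator hxI hkI h1 (fun h => hkS (hgrid.2 h))).trans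
            le_add_self
      have hvol : volume (I k) = 1 / n := by
        rw [hI, Real.volume_Icc, ← sub_div, Nat.cast_succ, add_sub_cancel_left,
          ENNReal.ofReal_div_of_pos hn0, ENNReal.ofReal_one, ENNReal.ofReal_natCast]
      calc volume (symmDiff S T ∩ I k) ≤ volume (I k) := measure_mono inter_subset_right
        _ = 1 / n := hvol
        _ ≤ _ := ENNReal.div_le_div_right hvar _
  calc volume (symmDiff S T)
      ≤ volume (⋃ k ∈ Finset.range n, (symmDiff S T ∩ I k)) := measure_mono hcover
    _ ≤ ∑ k ∈ Finset.range n, volume (symmDiff S T ∩ I k) := measure_biUnion_finset_le _ _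
    _ ≤ ∑ k ∈ Finset.range n, (eVariationOn (S.indicator (fun _ => (1 : ℝ))) (I k)
        + eVariationOn (T.indicator (fun _ => (1 : ℝ))) (I k)) / n := Finset.sum_le_sum hpiece
    _ = (eVariationOn (S.indicator (fun _ => (1 : ℝ))) (Icc 0 1)
        + eVariationOn (T.indicator (fun _ => (1 : ℝ))) (Icc 0 1)) / n := by
        simp only [div_eq_mul_inv]
        rw [← Finset.sum_mul, Finset.sum_add_distrib, hsum, hsum]
    _ ≤ 2 * W / n := ENNReal.div_le_div_right (by rw [two_mul]; exact add_le_add hSW hTW) _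

/-- The indicator is a difference `p - q` of monotone, hence measurable, functions, and `S` is its
level set at `1`. This is needed because pointwise ultrafilter limits of measurable sets need not be
measurable. -/
theorem measurableSet_of_boundedVariationOn {S : Set ℝ} (hS : S ⊆ Icc 0 1)
    (h : BoundedVariationOn (S.indicator (fun _ => (1 : ℝ))) (Icc 0 1)) : MeasurableSet S := by
  obtain ⟨p, q, hp, hq, hpq⟩ :=
    h.locallyBoundedVariationOn.exists_monotoneOn_sub_monotoneOn
  have hp' : Measurable fun x : Icc (0 : ℝ) 1 => p x :=
    Monotone.measurable fun a b hab => hp a.2 b.2 hab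
  have hq' : Measurable fun x : Icc (0 : ℝ) 1 => q x :=
    Monotone.measurable fun a b hab => hq a.2 b.2 hab
  have hm : MeasurableSet {x : Icc (0 : ℝ) 1 | p x - q x = 1} :=
    (hp'.sub hq') (measurableSet_singleton 1)
  convert measurableSet_Icc.subtype_image hm
  ext x
  simp only [mem_image, mem_ofPred_eq, Subtype.exists, exists_and_right, exists_eq_right]
  have hx : ∀ y, p y - q y = S.indicator (fun _ => (1 : ℝ)) y := fun y => by rw [hpq]; rfl
  constructor
  · intro h
    exact ⟨hS h, by rw [hx]; simp [h]⟩
  · rintro ⟨-, h⟩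
    rw [hx] at h
    by_contra hxS
    simp [hxS] at h

/-- The difference of the integrals is at most `∫ |f|` over the symmetric difference, which vanishes
by absolute continuity of the integral. -/
theorem tendsto_integral_of_tendsto_symmDiff {ι : Type*} {l : Filter ι} {S : ι → Set ℝ}
    {T : Set ℝ} {r : ι → K} {s : K}
    (hr : ∀ᶠ i in l, (r i).fn =ᵐ[unitMeasure] (S i).indicator (fun _ => (1 : ℝ)))
    (hs : s.fn =ᵐ[unitMeasure] T.indicator (fun _ => (1 : ℝ)))
    (h : Tendsto (fun i => volume (symmDiff (S i) T)) l (𝓝 0)) (f : Lp ℝ 1 unitMeasure) :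
    Tendsto (fun i => ∫ x, (r i).fn x * f x ∂unitMeasure) l
      (𝓝 (∫ x, s.fn x * f x ∂unitMeasure)) := by
  have hf : Integrable f unitMeasure := memLp_one_iff_integrable.1 (Lp.memLp f)
  have hint : ∀ r : K, Integrable (fun x => r.fn x * f x) unitMeasure := fun r =>
    (memLp_one_iff_integrable.1 ((Lp.memLp f).mul r.memLp : MemLp _ 1 _))
  rw [tendsto_iff_edist_tendsto_0]
  have h0 : Tendsto (unitMeasure ∘ fun i => symmDiff (S i) T) l (𝓝 0) :=
    tendsto_of_tendsto_of_tendsto_of_le_of_le tendsto_const_nhds h (fun _ => zero_le)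
      fun i => Measure.restrict_apply_le _ _
  refine tendsto_of_tendsto_of_tendsto_of_le_of_le' tendsto_const_nhds
    (tendsto_setLIntegral_zero (f := fun x => ‖f x‖ₑ) hf.2.ne h0)
    (Eventually.of_forall fun _ => zero_le) ?_
  filter_upwards [hr] with i hi
  rw [edist_eq_enorm_sub, ← integral_sub (hint _) (hint _)]
  refine (enorm_integral_le_lintegral_enorm _).trans
    (le_trans (lintegral_mono_ae ?_) (lintegral_indicator_le _ _))
  filter_upwards [hi, hs] with x h1 h2
  rw [h1, h2]
  by_cases hS : x ∈ S i <;> by_cases hT : x ∈ T <;> simp [hS, hT, indicator, mem_symmDiff]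

/-- Compactness of the set of admissible actuator shapes. -/
theorem isCompact_Kad (V : ℝ) (c : ℝ) : IsCompact (Kad V c) := by
  rw [isCompact_iff_ultrafilter_le_nhds]
  intro U hU
  have hUK : ∀ᶠ r in U, r ∈ Kad V c := le_principal_iff.1 hU
  choose! S hSm hS1 hrS hSV hSc using fun (r : K) (hr : r ∈ Kad V c) => hr
  -- An ultrafilter decides membership at every point, so pointwise convergence is automatic; this
  -- plays the role of Helly's selection theorem.
  set T : Set ℝ := {x | ∀ᶠ r in U, x ∈ S r} with hT
  have hTiff : ∀ x, ∀ᶠ r in U, (x ∈ S r ↔ x ∈ T) := by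
    intro x
    by_cases hx : x ∈ T
    · filter_upwards [show ∀ᶠ r in U, x ∈ S r from hx] with r hr
      exact iff_of_true hr hx
    · have : ∀ᶠ r in U, x ∉ S r := Ultrafilter.eventually_not.2 hx
      filter_upwards [this] with r hr
      exact iff_of_false hr hx
  have hT1 : T ⊆ Icc 0 1 := fun x hx => by
    obtain ⟨r, hr, hxr⟩ := (hUK.and hx).exists
    exact hS1 r hr hxr
  have hTV : eVariationOn (T.indicator (fun _ => (1 : ℝ))) (Icc 0 1) ≤ ENNReal.ofReal V := by
    by_contra! hlt
    have hlim : ∀ x ∈ Icc (0 : ℝ) 1, Tendsto (fun r => (S r).indicator (fun _ => (1 : ℝ)) x) U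
        (𝓝 (T.indicator (fun _ => (1 : ℝ)) x)) := by
      intro x _
      refine tendsto_const_nhds.congr' ?_
      filter_upwards [hTiff x] with r hr
      by_cases h : x ∈ T
      · simp [h, hr.2 h]
      · simp [h, mt hr.1 h]
    -- If the limit exceeded the bound, lower semicontinuity would make the sets near it exceed the
    -- bound as well.
    obtain ⟨r, hr, h1⟩ := (hUK.and (eVariationOn.lowerSemicontinuous_aux hlim hlt)).exists
    exact absurd (hSV r hr) (not_le.2 h1)
  have hTm : MeasurableSet T :=
    measurableSet_of_boundedVariationOn hT1 (ne_top_of_le_ne_top ENNReal.ofReal_ne_top hTV)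
  have hlim : Tendsto (fun r => volume (symmDiff (S r) T)) U (𝓝 0) := by
    have hbound : ∀ n : ℕ, 0 < n → ∀ᶠ r in U,
        volume (symmDiff (S r) T) ≤ 2 * ENNReal.ofReal V / n := by
      intro n hn
      have : ∀ᶠ r in U, ∀ k ∈ Finset.range n, ((k : ℝ) / n ∈ S r ↔ (k : ℝ) / n ∈ T) :=
        (Finset.eventually_all _).2 fun k _ => hTiff _
      filter_upwards [hUK, this] with r hr h
      exact volume_symmDiff_le (hS1 r hr) hT1 (hSV r hr) hTV hn
        fun k hk => h k (Finset.mem_range.2 hk)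
    have hn : Tendsto (fun n : ℕ => 2 * ENNReal.ofReal V / n) atTop (𝓝 0) := by
      have := ENNReal.Tendsto.const_div (a := 2 * ENNReal.ofReal V) ENNReal.tendsto_nat_nhds_top
        (Or.inr (by finiteness))
      rwa [ENNReal.div_top] at this
    rw [ENNReal.tendsto_nhds_zero]
    intro ε hε
    obtain ⟨n, h1, h2⟩ := ((ENNReal.tendsto_nhds_zero.1 hn ε hε).and (eventually_gt_atTop 0)).exists
    filter_upwards [hbound n h2] with r hr
    exact hr.trans h1
  have hTc : volume T = ENNReal.ofReal c := by
    refine le_antisymm ?_ ?_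
    · have h1 : Tendsto (fun r => ENNReal.ofReal c + volume (symmDiff (S r) T)) U
          (𝓝 (ENNReal.ofReal c + 0)) := hlim.const_add _
      rw [add_zero] at h1
      refine ge_of_tendsto h1 ?_
      filter_upwards [hUK] with r hr
      rw [← hSc r hr]
      refine (measure_mono fun x hx => ?_).trans (measure_union_le _ _)
      by_cases h : x ∈ S r
      · exact Or.inl h
      · exact Or.inr (Or.inr ⟨hx, h⟩)
    · have h1 : Tendsto (fun r => volume T + volume (symmDiff (S r) T)) U
          (𝓝 (volume T + 0)) := hlim.const_add _
      rw [add_zero] at h1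
      refine ge_of_tendsto h1 ?_
      filter_upwards [hUK] with r hr
      rw [← hSc r hr]
      refine (measure_mono fun x hx => ?_).trans (measure_union_le _ _)
      by_cases h : x ∈ T
      · exact Or.inl h
      · exact Or.inr (Or.inl ⟨hx, h⟩)
  refine ⟨shape hTm, ⟨T, hTm, hT1, fn_shape hTm, hTV, hTc⟩, ?_⟩
  rw [nhds_induced, ← tendsto_iff_comap]
  exact tendsto_pi_nhds.2 fun f =>
    tendsto_integral_of_tendsto_symmDiff (r := id) (hUK.mono hrS) (fn_shape hTm) hlim f

end Shapes

/-! ### Weak derivatives on the unit interval -/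

section WeakDeriv

theorem L2.integrable (f : L2) : Integrable f unitMeasure := (Lp.memLp f).integrable one_le_two

/-- Integration by parts for primitives of integrable functions. -/
theorem integral_primitive_mul_deriv {g : ℝ → ℝ} (hg : Integrable g unitMeasure) (a : ℝ)
    {φ φ' : ℝ → ℝ} (hφ : ∀ x, HasDerivAt φ (φ' x) x) (hφ' : Continuous φ') :
    ∫ x, (a + ∫ s in 0..x, g s) * φ' x ∂unitMeasure
      = (a + ∫ s in 0..1, g s) * φ 1 - a * φ 0 - ∫ x, g x * φ x ∂unitMeasure := by
  have hd : deriv φ = φ' := funext fun x => (hφ x).deriv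
  have hC1 : ContDiff ℝ 1 φ :=
    contDiff_one_iff_deriv.2 ⟨fun x => (hφ x).differentiableAt, hd ▸ hφ'⟩
  have hconst : AbsolutelyContinuousOnInterval (fun _ : ℝ => a) 0 1 :=
    (LipschitzWith.const _).lipschitzOnWith.absolutelyContinuousOnInterval
  have hG : AbsolutelyContinuousOnInterval (fun x => a + ∫ s in 0..x, g s) 0 1 :=
    hconst.add (absolutelyContinuous_primitive (τ := 1) zero_le_one hg)
  have h := hG.integral_mul_deriv_eq_deriv_mul hC1.contDiffOn.absolutelyContinuousOnInterval
  have e1 := integral_timeMeasure (τ := 1) zero_le_one fun x => (a + ∫ s in 0..x, g s) * φ' x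
  have e2 := integral_timeMeasure (τ := 1) zero_le_one fun x => g x * φ x
  have e3 : ∫ x in (0 : ℝ)..1, deriv (fun x => a + ∫ s in 0..x, g s) x * φ x
      = ∫ x in (0 : ℝ)..1, g x * φ x := by
    refine intervalIntegral_congr_timeMeasure (τ := 1) ?_ (right_mem_Icc.2 zero_le_one)
    filter_upwards [hasDerivAt_primitive (τ := 1) zero_le_one hg] with x hx
    rw [(hx.const_add a).deriv]
  rw [hd, e3, ← e1, ← e2] at h
  simp only [intervalIntegral.integral_same, add_zero] at h
  exact h

theorem IsTestFunction.apply_zero {φ : ℝ → ℝ} (h : IsTestFunction φ) : φ 0 = 0 := by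
  by_contra h0
  exact lt_irrefl _ (h.support (subset_tsupport _ h0)).1

theorem IsTestFunction.apply_one {φ : ℝ → ℝ} (h : IsTestFunction φ) : φ 1 = 0 := by
  by_contra h0
  exact lt_irrefl _ (h.support (subset_tsupport _ h0)).2

theorem IsTestFunction.hasDerivAt {φ : ℝ → ℝ} (h : IsTestFunction φ) (x : ℝ) :
    HasDerivAt φ (deriv φ x) x :=
  (h.smooth.differentiable (by simp) x).hasDerivAt

theorem IsTestFunction.integral_eq {φ : ℝ → ℝ} (h : IsTestFunction φ) (f : ℝ → ℝ) :
    ∫ x, f x * φ x ∂unitMeasure = ∫ x, f x * φ x := by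
  refine setIntegral_eq_integral_of_forall_compl_eq_zero fun x hx => ?_
  rw [image_eq_zero_of_notMem_tsupport fun h' => hx (h.support h'), mul_zero]

/-- A test function with integral zero is the derivative of a test function. -/
theorem IsTestFunction.exists_antideriv {χ : ℝ → ℝ} (h : IsTestFunction χ)
    (h0 : ∫ x, χ x ∂unitMeasure = 0) : ∃ φ, IsTestFunction φ ∧ deriv φ = χ := by
  obtain ⟨a, b, ha, hb, hab⟩ : ∃ a b : ℝ, 0 < a ∧ b < 1 ∧ tsupport χ ⊆ Icc a b := by
    rcases (tsupport χ).eq_empty_or_nonempty with he | hne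
    -- With empty support any `a > 0` and `b < 1` will do.
    · exact ⟨1, 0, one_pos, one_pos, by simp [he]⟩
    · obtain ⟨a, ha⟩ := h.compact.isCompact.exists_isLeast hne
      obtain ⟨b, hb⟩ := h.compact.isCompact.exists_isGreatest hne
      exact ⟨a, b, (h.support ha.1).1, (h.support hb.1).2, fun x hx => ⟨ha.2 hx, hb.2 hx⟩⟩
  have hc := h.smooth.continuous
  have hd : ∀ x, HasDerivAt (fun x => ∫ s in 0..x, χ s) (χ x) x := fun x =>
    (hc.integral_hasStrictDerivAt 0 x).hasDerivAt
  have hderiv : deriv (fun x => ∫ s in 0..x, χ s) = χ := funext fun x => (hd x).deriv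
  have hχ : ∀ x, x ∉ Icc a b → χ x = 0 := fun x hx =>
    image_eq_zero_of_notMem_tsupport fun h' => hx (hab h')
  have h01 : ∫ s in (0 : ℝ)..1, χ s = 0 := by
    rw [← integral_timeMeasure zero_le_one]
    exact h0
  -- Left of `a` nothing has been integrated yet; right of `b` the whole, zero, integral has been.
  have hsupp : Function.support (fun x => ∫ s in 0..x, χ s) ⊆ Icc a b := by
    intro x hx
    by_contra hx'
    refine hx ?_
    rw [mem_Icc, not_and_or, not_le, not_le] at hx'
    rcases hx' with hx' | hx'
    · refine intervalIntegral.integral_zero_ae (Eventually.of_forall fun s hs => hχ s fun h' => ?_)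
      have : s ≤ max 0 x := hs.2
      have h2 : max 0 x < a := max_lt ha hx'
      linarith [h'.1]
    · have e : ∫ s in (0 : ℝ)..x, χ s = (∫ s in (0 : ℝ)..1, χ s) + ∫ s in (1 : ℝ)..x, χ s :=
        (intervalIntegral.integral_add_adjacent_intervals (hc.intervalIntegrable _ _)
          (hc.intervalIntegrable _ _)).symm
      simp only
      rw [e, h01, zero_add]
      refine intervalIntegral.integral_zero_ae (Eventually.of_forall fun s hs => hχ s fun h' => ?_)
      have : min 1 x < s := hs.1
      have h2 : b < min 1 x := lt_min hb hx'
      linarith [h'.2]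
  have hts : tsupport (fun x => ∫ s in 0..x, χ s) ⊆ Icc a b :=
    closure_minimal hsupp isClosed_Icc
  refine ⟨_, ⟨?_, ?_, ?_⟩, hderiv⟩
  · rw [contDiff_infty_iff_deriv, hderiv]
    exact ⟨fun x => (hd x).differentiableAt, h.smooth⟩
  · exact isCompact_Icc.of_isClosed_subset (isClosed_tsupport _) hts
  · exact hts.trans fun x hx => ⟨ha.trans_le hx.1, hx.2.trans_lt hb⟩

theorem exists_testFunction_integral_one :
    ∃ ρ, IsTestFunction ρ ∧ ∫ x, ρ x ∂unitMeasure = 1 := by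
  let B : ContDiffBump (1 / 2 : ℝ) := ⟨1 / 8, 1 / 4, by norm_num, by norm_num⟩
  have hB : IsTestFunction (B.normed volume) := by
    refine ⟨B.contDiff_normed (n := ⊤), B.hasCompactSupport_normed, ?_⟩
    rw [B.tsupport_normed_eq, Real.closedBall_eq_Icc]
    intro x hx
    have h1 : (1 / 2 : ℝ) - 1 / 4 ≤ x := hx.1
    have h2 : x ≤ (1 / 2 : ℝ) + 1 / 4 := hx.2
    constructor <;> linarith
  refine ⟨_, hB, ?_⟩
  have := hB.integral_eq fun _ => 1
  simp only [one_mul] at this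
  rw [this, B.integral_normed]

/-- The lemma of du Bois-Reymond: a function with weak derivative zero is constant. -/
theorem ae_const_of_integral_mul_deriv_eq_zero {f : ℝ → ℝ} (hf : Integrable f unitMeasure)
    (h : ∀ φ, IsTestFunction φ → ∫ x, f x * deriv φ x ∂unitMeasure = 0) :
    ∃ c, f =ᵐ[unitMeasure] fun _ => c := by
  obtain ⟨ρ, hρ, hρ1⟩ := exists_testFunction_integral_one
  have hmul : ∀ {ψ : ℝ → ℝ}, Continuous ψ → HasCompactSupport ψ →
      Integrable (fun x => f x * ψ x) unitMeasure := by
    intro ψ hψ hs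
    obtain ⟨C, hC⟩ := hs.exists_bound_of_continuous hψ
    exact hf.mul_bdd hψ.aestronglyMeasurable (Eventually.of_forall hC)
  set c := ∫ x, f x * ρ x ∂unitMeasure with hc
  refine ⟨c, ?_⟩
  have key : ∀ ψ, IsTestFunction ψ → ∫ x, (f x - c) * ψ x ∂unitMeasure = 0 := by
    intro ψ hψ
    set m := ∫ x, ψ x ∂unitMeasure with hm
    have hψi : Integrable ψ unitMeasure :=
      (hψ.smooth.continuous.integrable_of_hasCompactSupport hψ.compact).restrict
    have hρi : Integrable ρ unitMeasure :=
      (hρ.smooth.continuous.integrable_of_hasCompactSupport hρ.compact).restrict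
    -- Subtracting a multiple of `ρ` makes the integral zero, so the result is the derivative of a
    -- test function and the hypothesis applies.
    have hχ : IsTestFunction fun x => ψ x - m * ρ x := by
      refine ⟨hψ.smooth.sub (contDiff_const.mul hρ.smooth),
        hψ.compact.sub (hρ.compact.mul_left (f := fun _ => m)), ?_⟩
      refine (tsupport_sub ψ fun x => m * ρ x).trans (union_subset hψ.support ?_)
      exact (tsupport_mul_subset_right (f := fun _ => m)).trans hρ.support
    obtain ⟨φ, hφ, hφχ⟩ := hχ.exists_antideriv (by
      rw [integral_sub hψi (hρi.const_mul m), integral_const_mul, hρ1, mul_one, sub_self])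
    have h1 := h φ hφ
    rw [hφχ] at h1
    have e : ∀ x, f x * (ψ x - m * ρ x) = f x * ψ x - m * (f x * ρ x) := fun x => by ring
    simp only [e] at h1
    rw [integral_sub (hmul hψ.smooth.continuous hψ.compact)
      ((hmul hρ.smooth.continuous hρ.compact).const_mul m), integral_const_mul, ← hc] at h1
    simp only [sub_mul]
    rw [integral_sub (hmul hψ.smooth.continuous hψ.compact) (hψi.const_mul c), integral_const_mul,
      ← hm]
    linarith
  have hloc : LocallyIntegrableOn (fun x => f x - c) (Ioo 0 1) volume :=
    (IntegrableOn.sub hf (integrable_const c)).locallyIntegrableOn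
  have := isOpen_Ioo.ae_eq_zero_of_integral_contDiff_smul_eq_zero hloc fun ψ h1 h2 h3 => by
    have hψ : IsTestFunction ψ := ⟨h1, h2, h3⟩
    have h4 := key ψ hψ
    rw [hψ.integral_eq fun x => f x - c] at h4
    simpa only [smul_eq_mul, mul_comm] using h4
  rw [Filter.EventuallyEq, unitMeasure, ae_restrict_iff' measurableSet_Ioo]
  filter_upwards [this] with x hx hx'
  exact sub_eq_zero.1 (hx hx')

/-- `f` minus the primitive of `g` has weak derivative zero, so du Bois-Reymond applies. This
supplies the absolutely continuous representative needed for boundary values. -/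
theorem HasWeakDeriv.ae_eq {f g : L2} (h : HasWeakDeriv f g) :
    ∃ c, f =ᵐ[unitMeasure] fun x => c + ∫ s in 0..x, g s := by
  have hG : Integrable (fun x => ∫ s in 0..x, g s) unitMeasure :=
    (memLp_primitive (τ := 1) zero_le_one g).integrable one_le_two
  obtain ⟨c, hc⟩ := ae_const_of_integral_mul_deriv_eq_zero (f.integrable.sub hG) fun φ hφ => by
    have h1 := integral_primitive_mul_deriv g.integrable 0 hφ.hasDerivAt hφ.deriv_continuous
    have h2 := h φ hφ
    simp only [zero_add, hφ.apply_one, hφ.apply_zero, mul_zero, sub_zero, zero_sub] at h1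
    have hφb : Integrable (fun x => (∫ s in 0..x, g s) * deriv φ x) unitMeasure := by
      obtain ⟨C, hC⟩ := hφ.compact.deriv.exists_bound_of_continuous hφ.deriv_continuous
      exact hG.mul_bdd hφ.deriv_continuous.aestronglyMeasurable (Eventually.of_forall hC)
    simp only [Pi.sub_apply, sub_mul]
    rw [integral_sub (integrable_mul_test f hφ.deriv_continuous hφ.compact.deriv) hφb, h1, h2,
      sub_self]
  refine ⟨c, ?_⟩
  filter_upwards [hc] with x hx
  rw [← hx, Pi.sub_apply]
  ring

theorem continuousOn_const_add_primitive (g : L2) (c : ℝ) :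
    ContinuousOn (fun x => c + ∫ s in 0..x, g s) (Icc 0 1) :=
  (continuousOn_primitive_timeMeasure (τ := 1) zero_le_one g.integrable).const_add c

/-- Integration by parts against functions that vanish at the end points. -/
theorem IsH2H10.integral_mul_deriv2 {f g : L2} (h : IsH2H10 f g) {φ φ' φ'' : ℝ → ℝ}
    (hφ : ∀ x, HasDerivAt φ (φ' x) x) (hφ' : ∀ x, HasDerivAt φ' (φ'' x) x)
    (hφ'' : Continuous φ'') (h0 : φ 0 = 0) (h1 : φ 1 = 0) :
    ∫ x, f x * φ'' x ∂unitMeasure = ∫ x, g x * φ x ∂unitMeasure := by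
  obtain ⟨⟨f₁, hf, hf₁⟩, F, hF, hfF, hF0, hF1⟩ := h
  obtain ⟨c₀, hc₀⟩ := hf.ae_eq
  obtain ⟨c₁, hc₁⟩ := hf₁.ae_eq
  -- Two continuous representatives coincide on the closed interval, so the zero boundary values
  -- pass to the primitive: `c₀ = 0` and `∫ f₁ = 0`.
  have hEq : EqOn F (fun x => c₀ + ∫ s in 0..x, f₁ s) (Icc 0 1) := by
    refine Measure.eqOn_Icc_of_ae_eq volume zero_ne_one ?_ hF
      (continuousOn_const_add_primitive f₁ c₀)
    rw [← unitMeasure_eq_restrict_Icc]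
    exact hfF.symm.trans hc₀
  have e0 := hEq (left_mem_Icc.2 zero_le_one)
  have e1 := hEq (right_mem_Icc.2 zero_le_one)
  rw [hF0] at e0
  rw [hF1] at e1
  simp only [intervalIntegral.integral_same, add_zero] at e0 e1
  subst e0
  have hcφ' : Continuous φ' := continuous_iff_continuousAt.2 fun x => (hφ' x).continuousAt
  have i1 := integral_primitive_mul_deriv f₁.integrable 0 hφ' hφ''
  have i2 := integral_primitive_mul_deriv g.integrable c₁ hφ hcφ'
  rw [← e1, zero_mul, zero_mul, sub_zero, zero_sub] at i1
  rw [h0, h1, mul_zero, mul_zero, sub_zero, zero_sub] at i2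
  have j1 : ∫ x, f x * φ'' x ∂unitMeasure
      = ∫ x, (0 + ∫ s in 0..x, f₁ s) * φ'' x ∂unitMeasure := by
    refine integral_congr_ae ?_
    filter_upwards [hc₀] with x hx
    rw [hx]
  have j2 : ∫ x, f₁ x * φ' x ∂unitMeasure
      = ∫ x, (c₁ + ∫ s in 0..x, g s) * φ' x ∂unitMeasure := by
    refine integral_congr_ae ?_
    filter_upwards [hc₁] with x hx
    rw [hx]
  rw [j1, i1, j2, i2, neg_neg]

theorem hasWeakDeriv_of_ae_eq {f g : L2} {c : ℝ}
    (h : f =ᵐ[unitMeasure] fun x => c + ∫ s in 0..x, g s) : HasWeakDeriv f g := by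
  intro φ hφ
  have h1 := integral_primitive_mul_deriv g.integrable c hφ.hasDerivAt hφ.deriv_continuous
  rw [hφ.apply_one, hφ.apply_zero, mul_zero, mul_zero, sub_zero, zero_sub] at h1
  rw [← h1]
  refine integral_congr_ae ?_
  filter_upwards [h] with x hx
  rw [hx]

theorem exists_coeFn_eq_const_add_primitive (g : L2) (c : ℝ) :
    ∃ f : L2, f =ᵐ[unitMeasure] fun x => c + ∫ s in 0..x, g s :=
  ⟨((memLp_const c).add (memLp_primitive (τ := 1) zero_le_one g)).toLp _, MemLp.coeFn_toLp _⟩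

/-- Solvability of the Dirichlet problem `f'' = g`, `f(0) = f(1) = 0`. -/
theorem exists_isH2H10 (g : L2) : ∃ f, IsH2H10 f g := by
  -- Subtracting from the primitive `p` of `g` its mean gives `f₁` with integral zero, which is the
  -- condition `f(1) = 0`.
  obtain ⟨p, hp⟩ := exists_coeFn_eq_const_add_primitive g 0
  obtain ⟨f₁, hf₁⟩ := exists_coeFn_eq_const_add_primitive g (-∫ x in (0 : ℝ)..1, p x)
  obtain ⟨f, hf⟩ := exists_coeFn_eq_const_add_primitive f₁ 0
  refine ⟨f, ⟨f₁, hasWeakDeriv_of_ae_eq hf, hasWeakDeriv_of_ae_eq hf₁⟩, _,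
    continuousOn_const_add_primitive f₁ 0, hf, by simp, ?_⟩
  have e : ∫ s in (0 : ℝ)..1, f₁ s = ∫ s in (0 : ℝ)..1, (p s - ∫ x in (0 : ℝ)..1, p x) := by
    refine intervalIntegral_congr_timeMeasure (τ := 1) ?_ (right_mem_Icc.2 zero_le_one)
    filter_upwards [show ∀ᵐ x ∂timeMeasure 1, _ from hp, show ∀ᵐ x ∂timeMeasure 1, _ from hf₁]
      with x h1 h2
    rw [h1, h2]
    ring
  simp only [e, zero_add]
  rw [intervalIntegral.integral_sub
    (intervalIntegrable_of_timeMeasure zero_le_one (p.integrable : Integrable p (timeMeasure 1)))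
    (by simp)]
  simp

end WeakDeriv

/-! ### The sine basis -/

section Sine

/-- The frequency `(n + 1) π`. -/
def freq (n : ℕ) : ℝ := (n + 1) * Real.pi

/-- The function `√2 sin ((n + 1) π x)`. -/
def sineFn (n : ℕ) (x : ℝ) : ℝ := √2 * Real.sin (freq n * x)

theorem continuous_sineFn (n : ℕ) : Continuous (sineFn n) := by
  unfold sineFn; fun_prop

/-- The normalized eigenfunction `√2 sin ((n + 1) π x)` as an element of `L²(0,1)`. -/
def sineMode (n : ℕ) : L2 :=
  (memLp_timeMeasure_of_continuous (τ := 1) (continuous_sineFn n)).toLp (sineFn n)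

theorem coeFn_sineMode (n : ℕ) : sineMode n =ᵐ[unitMeasure] sineFn n := MemLp.coeFn_toLp _

theorem inner_sineMode (n : ℕ) (f : L2) :
    inner ℝ (sineMode n) f = ∫ x, f x * sineFn n x ∂unitMeasure := by
  rw [L2.inner_def]
  refine integral_congr_ae ?_
  filter_upwards [coeFn_sineMode n] with x hx
  rw [hx]
  rfl

theorem sin_freq (n : ℕ) : Real.sin (freq n) = 0 := by
  have := Real.sin_nat_mul_pi (n + 1)
  push_cast at this
  exact this

theorem IsH2H10.inner_sineMode {f g : L2} (h : IsH2H10 f g) (n : ℕ) :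
    inner ℝ (sineMode n) g = -freq n ^ 2 * inner ℝ (sineMode n) f := by
  have hφ : ∀ x, HasDerivAt (sineFn n) (√2 * (Real.cos (freq n * x) * freq n)) x := fun x => by
    have := (((hasDerivAt_id x).const_mul (freq n)).sin).const_mul (√2)
    rwa [mul_one] at this
  have hφ' : ∀ x, HasDerivAt (fun x => √2 * (Real.cos (freq n * x) * freq n))
      (-freq n ^ 2 * sineFn n x) x := fun x => by
    have := ((((hasDerivAt_id x).const_mul (freq n)).cos).mul_const (freq n)).const_mul (√2)
    refine this.congr_deriv ?_
    change √2 * (-Real.sin (freq n * x) * (freq n * 1) * freq n)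
      = -freq n ^ 2 * (√2 * Real.sin (freq n * x))
    ring
  have key := h.integral_mul_deriv2 hφ hφ' ((continuous_sineFn n).const_mul _) (by simp [sineFn])
    (by simp [sineFn, sin_freq])
  rw [Beam.inner_sineMode, Beam.inner_sineMode, ← key, ← integral_const_mul]
  exact integral_congr_ae (Eventually.of_forall fun x => by ring)

theorem integral_cos_int_mul_pi (k : ℤ) :
    ∫ x, Real.cos (k * Real.pi * x) ∂unitMeasure = if k = 0 then 1 else 0 := by
  have e := integral_timeMeasure (τ := 1) zero_le_one fun x => Real.cos (k * Real.pi * x)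
  refine Eq.trans e ?_
  split_ifs with hk
  · simp [hk]
  · have hk' : (k : ℝ) * Real.pi ≠ 0 := mul_ne_zero (by exact_mod_cast hk) Real.pi_ne_zero
    rw [intervalIntegral.integral_comp_mul_left _ hk', integral_cos, mul_one, mul_zero,
      Real.sin_int_mul_pi, Real.sin_zero, sub_zero, smul_zero]

theorem orthonormal_sineMode : Orthonormal ℝ sineMode := by
  rw [orthonormal_iff_ite]
  intro m n
  have hc : ∀ k : ℤ, Integrable (fun x => Real.cos (k * Real.pi * x)) unitMeasure := fun k =>
    (memLp_timeMeasure_of_continuous (τ := 1)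
      (by fun_prop : Continuous fun x => Real.cos (k * Real.pi * x))).integrable one_le_two
  have e : ∫ x, sineMode n x * sineFn m x ∂unitMeasure
      = ∫ x, (Real.cos (((m - n : ℤ) : ℝ) * Real.pi * x)
        - Real.cos (((m + n + 2 : ℤ) : ℝ) * Real.pi * x)) ∂unitMeasure := by
    refine integral_congr_ae ?_
    filter_upwards [coeFn_sineMode n] with x hx
    have h2 : √2 * √2 = 2 := Real.mul_self_sqrt (by norm_num)
    have h3 := Real.two_mul_sin_mul_sin (freq m * x) (freq n * x)
    have h4 : ((m - n : ℤ) : ℝ) * Real.pi * x = freq m * x - freq n * x := by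
      simp only [freq]; push_cast; ring
    have h5 : ((m + n + 2 : ℤ) : ℝ) * Real.pi * x = freq m * x + freq n * x := by
      simp only [freq]; push_cast; ring
    rw [hx, h4, h5, ← h3]
    simp only [sineFn]
    linear_combination (Real.sin (freq m * x) * Real.sin (freq n * x)) * h2
  rw [inner_sineMode, e, integral_sub (hc _) (hc _), integral_cos_int_mul_pi,
    integral_cos_int_mul_pi, if_neg (show ¬(m + n + 2 : ℤ) = 0 by omega), sub_zero]
  simp only [sub_eq_zero, Nat.cast_inj]

/-- Completeness of the sine system, from Parseval's identity for the odd extension. -/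
theorem eq_zero_of_inner_sineMode {f : L2} (h : ∀ n, inner ℝ (sineMode n) f = 0) : f = 0 := by
  have hsin : ∀ k : ℕ, ∫ x, f x * Real.sin (k * Real.pi * x) ∂unitMeasure = 0 := by
    intro k
    rcases k with _ | n
    · simp
    · have h2 : √2 ≠ 0 := by positivity
      have := h n
      rw [inner_sineMode] at this
      have e : ∀ x, f x * sineFn n x = √2 * (f x * Real.sin (((n + 1 : ℕ) : ℝ) * Real.pi * x)) := by
        intro x
        simp only [sineFn, freq]
        push_cast
        ring
      simp only [e] at this
      rw [integral_const_mul] at this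
      exact (mul_eq_zero.1 this).resolve_left h2
  have hsin' : ∀ k : ℤ, ∫ x, f x * Real.sin (k * Real.pi * x) ∂unitMeasure = 0 := by
    intro k
    obtain ⟨n, rfl | rfl⟩ := k.eq_nat_or_neg
    · exact_mod_cast hsin n
    · have e : ∀ x, f x * Real.sin (((-n : ℤ) : ℝ) * Real.pi * x)
          = -(f x * Real.sin (n * Real.pi * x)) := by
        intro x
        push_cast
        rw [neg_mul, neg_mul, Real.sin_neg, mul_neg]
      simp only [e]
      rw [integral_neg, hsin n, neg_zero]
  set f₀ : ℝ → ℝ := (Ioo 0 1).indicator f with hf₀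
  have hf₀m : MemLp f₀ 2 volume := (memLp_indicator_iff_restrict measurableSet_Ioo).2 (Lp.memLp f)
  have hf₀n : MemLp (fun x => f₀ (-x)) 2 volume :=
    hf₀m.comp_measurePreserving (Measure.measurePreserving_neg volume)
  -- The odd extension of `f` to `(-1,1)`: only sines enter its Fourier coefficients on this
  -- interval of length `2`.
  set g : ℝ → ℝ := fun x => f₀ x - f₀ (-x) with hg
  have hgm : MemLp g 2 volume := hf₀m.sub hf₀n
  have hgC : MemLp (fun x => (g x : ℂ)) 2 (volume.restrict (Ioc (-1) 1)) :=
    (hgm.restrict _).ofReal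
  have hint : ∀ {F : ℝ → ℝ}, MemLp F 2 volume →
      IntervalIntegrable (fun x => (F x : ℂ)) volume (-1) 1 := by
    intro F hF
    have h1 : IntegrableOn F (Ioc (-1) 1) volume := (hF.restrict _).integrable one_le_two
    rw [intervalIntegrable_iff_integrableOn_Ioc_of_le (by norm_num)]
    exact h1.ofReal
  have hcoeff : ∀ n, fourierCoeffOn (show (-1 : ℝ) < 1 by norm_num) (fun x => (g x : ℂ)) n = 0 := by
    intro n
    rw [fourierCoeffOn_eq_integral]
    set E : ℝ → ℂ := fun x => fourier (-n) (x : AddCircle ((1 : ℝ) - -1)) with hE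
    have hEe : ∀ x : ℝ, E x = Complex.exp ((-(n * Real.pi * x) : ℝ) * Complex.I) := by
      intro x
      simp only [hE]
      rw [fourier_coe_apply]
      congr 1
      push_cast
      ring
    have hEc : Continuous E := by
      simp only [funext hEe]
      fun_prop
    have hEd : ∀ x, E x - E (-x) = -(2 * Complex.I) * (Real.sin (n * Real.pi * x) : ℂ) := by
      intro x
      rw [hEe, hEe, Complex.exp_mul_I, Complex.exp_mul_I, ← Complex.ofReal_cos,
        ← Complex.ofReal_cos, ← Complex.ofReal_sin, ← Complex.ofReal_sin, mul_neg, neg_neg,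
        Real.cos_neg, Real.sin_neg]
      push_cast
      ring
    have i1 : IntervalIntegrable (fun x => E x * (f₀ x : ℂ)) volume (-1) 1 :=
      (hint hf₀m).continuousOn_mul hEc.continuousOn
    have i2 : IntervalIntegrable (fun x => E x * (f₀ (-x) : ℂ)) volume (-1) 1 :=
      (hint hf₀n).continuousOn_mul hEc.continuousOn
    have i3 : IntervalIntegrable (fun x => E (-x) * (f₀ x : ℂ)) volume (-1) 1 :=
      (hint hf₀m).continuousOn_mul (hEc.comp continuous_neg).continuousOn
    have e1 : ∫ x in (-1 : ℝ)..1, E x * (f₀ (-x) : ℂ) = ∫ x in (-1 : ℝ)..1, E (-x) * (f₀ x : ℂ) := by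
      have := intervalIntegral.integral_comp_neg (a := -1) (b := 1) fun x => E (-x) * (f₀ x : ℂ)
      simpa using this
    have e2 : ∫ x in (-1 : ℝ)..1, E x • (g x : ℂ)
        = ∫ x in (-1 : ℝ)..1, -(2 * Complex.I)
          * ((f₀ x * Real.sin (n * Real.pi * x) : ℝ) : ℂ) := by
      have s1 : ∫ x in (-1 : ℝ)..1, E x • (g x : ℂ)
          = (∫ x in (-1 : ℝ)..1, E x * (f₀ x : ℂ)) - ∫ x in (-1 : ℝ)..1, E x * (f₀ (-x) : ℂ) := by
        rw [← intervalIntegral.integral_sub i1 i2]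
        refine intervalIntegral.integral_congr fun x _ => ?_
        simp only [hg, smul_eq_mul]
        push_cast
        ring
      rw [s1, e1, ← intervalIntegral.integral_sub i1 i3]
      refine intervalIntegral.integral_congr fun x _ => ?_
      have := hEd x
      push_cast at this ⊢
      linear_combination (f₀ x : ℂ) * this
    have e3 : ∫ x in (-1 : ℝ)..1, f₀ x * Real.sin (n * Real.pi * x) = 0 := by
      rw [← hsin' n, intervalIntegral.integral_of_le (by norm_num)]
      have : ∀ x, f₀ x * Real.sin (n * Real.pi * x)
          = (Ioo 0 1).indicator (fun x => f x * Real.sin (n * Real.pi * x)) x := fun x => by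
        simp only [hf₀, indicator]
        split_ifs <;> simp
      simp only [this]
      rw [setIntegral_indicator measurableSet_Ioo, inter_eq_right.2 (show Ioo (0 : ℝ) 1 ⊆ Ioc (-1) 1
        from fun x hx => ⟨by linarith [hx.1], hx.2.le⟩)]
      rfl
    rw [e2, intervalIntegral.integral_const_mul, intervalIntegral.integral_ofReal, e3]
    simp
  -- All Fourier coefficients vanish, so Parseval gives `∫ |g|² = 0`, and `g = f` on `(0,1)`.
  have hP := hasSum_sq_fourierCoeffOn (show (-1 : ℝ) < 1 by norm_num) hgC
  simp only [hcoeff, norm_zero, ne_eq, OfNat.ofNat_ne_zero, not_false_eq_true, zero_pow] at hP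
  have hP0 := hP.unique hasSum_zero
  have hI : ∫ x in (-1 : ℝ)..1, ‖(g x : ℂ)‖ ^ 2 = 0 := by
    rcases smul_eq_zero.1 hP0 with h | h
    · norm_num at h
    · exact h
  rw [intervalIntegral.integral_of_le (by norm_num), integral_eq_zero_iff_of_nonneg
    (fun x => by positivity) (hgC.integrable_norm_pow two_ne_zero)] at hI
  rw [Lp.eq_zero_iff_ae_eq_zero]
  refine (ae_restrict_iff' measurableSet_Ioo).2 ?_
  rw [Filter.EventuallyEq, ae_restrict_iff' measurableSet_Ioc] at hI
  filter_upwards [hI] with x hx h01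
  have h1 := hx ⟨by linarith [h01.1], h01.2.le⟩
  have h2 : f₀ (-x) = 0 := indicator_of_notMem (fun h => by linarith [h.1, h01.1]) _
  have h3 : f₀ x = f x := indicator_of_mem h01 _
  simpa [hg, h2, h3] using h1

/-- For the converse, the Dirichlet solution with right-hand side `g` has the same sine coefficients
as `f`, as the frequencies are nonzero; completeness makes the two equal. Regularity and boundary
conditions thus become countably many linear equations. -/
theorem isH2H10_iff {f g : L2} :
    IsH2H10 f g ↔ ∀ n, inner ℝ (sineMode n) g = -freq n ^ 2 * inner ℝ (sineMode n) f := by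
  refine ⟨fun h n => h.inner_sineMode n, fun h => ?_⟩
  obtain ⟨f', hf'⟩ := exists_isH2H10 g
  have : f - f' = 0 := by
    refine eq_zero_of_inner_sineMode fun n => ?_
    have h1 := hf'.inner_sineMode n
    have h2 : -freq n ^ 2 ≠ 0 := by
      have : 0 < freq n := mul_pos (by positivity) Real.pi_pos
      exact (neg_neg_of_pos (by positivity)).ne
    rw [h n] at h1
    rw [inner_sub_right, mul_left_cancel₀ h2 h1, sub_self]
  rwa [sub_eq_zero.1 this]

/-- The sine functions as a Hilbert basis of `L²(0,1)`. -/
def sineBasis : HilbertBasis ℕ ℝ L2 :=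
  HilbertBasis.mkOfOrthogonalEqBot orthonormal_sineMode (by
    rw [Submodule.eq_bot_iff]
    intro f hf
    refine eq_zero_of_inner_sineMode fun n => ?_
    exact (Submodule.mem_orthogonal _ _).1 hf _ (Submodule.subset_span (mem_range_self n)))

theorem tendsto_sum_sineMode (f : L2) :
    Tendsto (fun N => ∑ n ∈ Finset.range N, inner ℝ (sineMode n) f • sineMode n) atTop (𝓝 f) := by
  have h := (sineBasis.hasSum_repr f).tendsto_sum_nat
  have hb : ∀ n, sineBasis n = sineMode n := fun n => by
    rw [sineBasis, HilbertBasis.coe_mkOfOrthogonalEqBot]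
  simpa only [HilbertBasis.repr_apply_apply, hb] using h

theorem inner_sineMode_sum (a : ℕ → ℝ) (N m : ℕ) :
    inner ℝ (sineMode m) (∑ n ∈ Finset.range N, a n • sineMode n) = if m < N then a m else 0 := by
  simp only [inner_sum, inner_smul_right, orthonormal_iff_ite.1 orthonormal_sineMode, mul_ite,
    mul_one, mul_zero, Finset.sum_ite_eq, Finset.mem_range]

end Sine

/-! ### Modal projections of the state space -/

section Modes

/-- The sine characterisation exhibits the space as an intersection of zero sets of continuous
functionals; completeness of `H` follows. -/
theorem isClosed_stateSpace : IsClosed (stateSpace : Set (PiLp 2 (fun _ : Fin 3 => L2))) := by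
  have e : (stateSpace : Set (PiLp 2 (fun _ : Fin 3 => L2)))
      = ⋂ n, {z | inner ℝ (sineMode n) (z 1) = -freq n ^ 2 * inner ℝ (sineMode n) (z 0)} := by
    ext z
    rw [mem_iInter]
    exact isH2H10_iff
  rw [e]
  refine isClosed_iInter fun n => isClosed_eq ?_ ?_ <;> fun_prop

instance : CompleteSpace H := isClosed_stateSpace.completeSpace_coe

instance : SecondCountableTopology L2 := by
  have : Fact ((2 : ℝ≥0∞) ≠ ⊤) := ⟨by norm_num⟩
  have : IsSeparable unitMeasure := by unfold unitMeasure; infer_instance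
  exact Lp.SecondCountableTopology

instance : SecondCountableTopology H := inferInstance

end Modes

/-! ### Modal Galerkin approximation of the beam -/

section ModalGalerkin

/-- The coordinates `w`, `∂ₓₓ w`, `v` of a state. -/
def coordL (i : Fin 3) : H →L[ℝ] L2 :=
  PiLp.proj 2 (fun _ : Fin 3 => L2) i ∘L stateSpace.subtypeL

theorem coordL_apply (i : Fin 3) (z : H) : coordL i z = z.1 i := rfl

/-- The `n`-th modal coefficient of a coordinate of a state. -/
def modalCoeff (i : Fin 3) (n : ℕ) : H →L[ℝ] ℝ := innerSL ℝ (sineMode n) ∘L coordL i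

theorem modalCoeff_apply (i : Fin 3) (n : ℕ) (z : H) :
    modalCoeff i n z = inner ℝ (sineMode n) (z.1 i) := rfl

theorem isH2H10_sineMode (n : ℕ) : IsH2H10 (sineMode n) (-freq n ^ 2 • sineMode n) :=
  isH2H10_iff.2 fun m => by
    rw [inner_smul_right, orthonormal_iff_ite.1 orthonormal_sineMode]
    split_ifs with h
    · rw [h]
    · simp

/-- The state `(sin, 0)`. -/
def dispMode (n : ℕ) : H :=
  ⟨WithLp.toLp 2 ![sineMode n, -freq n ^ 2 • sineMode n, 0], isH2H10_sineMode n⟩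

/-- The state `(0, sin)`. -/
def velMode (n : ℕ) : H := ⟨WithLp.toLp 2 ![0, 0, sineMode n], IsH2H10.zero⟩

/-- The state with displacement coefficients `a` and velocity coefficients `b`. -/
def modalSum (N : ℕ) (a b : ℕ → ℝ) : H :=
  ∑ n ∈ Finset.range N, (a n • dispMode n + b n • velMode n)

theorem modalSum_congr {N : ℕ} {a a' b b' : ℕ → ℝ} (ha : ∀ n < N, a n = a' n)
    (hb : ∀ n < N, b n = b' n) : modalSum N a b = modalSum N a' b' :=
  Finset.sum_congr rfl fun n hn => by
    rw [ha n (Finset.mem_range.1 hn), hb n (Finset.mem_range.1 hn)]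

theorem coordL_modalSum (i : Fin 3) (N : ℕ) (a b : ℕ → ℝ) : coordL i (modalSum N a b)
    = ∑ n ∈ Finset.range N, (a n • coordL i (dispMode n) + b n • coordL i (velMode n)) := by
  simp only [modalSum, map_sum, map_add, map_smul]

theorem modalSum_zero_coord (N : ℕ) (a b : ℕ → ℝ) :
    (modalSum N a b).1 0 = ∑ n ∈ Finset.range N, a n • sineMode n := by
  rw [← coordL_apply, coordL_modalSum]
  simp [coordL_apply, dispMode, velMode]

theorem modalSum_one_coord (N : ℕ) (a b : ℕ → ℝ) :
    (modalSum N a b).1 1 = ∑ n ∈ Finset.range N, (-freq n ^ 2 * a n) • sineMode n := by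
  rw [← coordL_apply, coordL_modalSum]
  refine Finset.sum_congr rfl fun n _ => ?_
  simp [coordL_apply, dispMode, velMode, smul_smul, mul_comm]

theorem modalSum_two_coord (N : ℕ) (a b : ℕ → ℝ) :
    (modalSum N a b).1 2 = ∑ n ∈ Finset.range N, b n • sineMode n := by
  rw [← coordL_apply, coordL_modalSum]
  simp [coordL_apply, dispMode, velMode]

theorem modalCoeff_zero_modalSum (N m : ℕ) (a b : ℕ → ℝ) :
    modalCoeff 0 m (modalSum N a b) = if m < N then a m else 0 := by
  rw [modalCoeff_apply, modalSum_zero_coord, inner_sineMode_sum]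

theorem modalCoeff_two_modalSum (N m : ℕ) (a b : ℕ → ℝ) :
    modalCoeff 2 m (modalSum N a b) = if m < N then b m else 0 := by
  rw [modalCoeff_apply, modalSum_two_coord, inner_sineMode_sum]

theorem modalCoeff_one (n : ℕ) (z : H) : modalCoeff 1 n z = -freq n ^ 2 * modalCoeff 0 n z :=
  IsH2H10.inner_sineMode z.2 n

theorem isH2H10_sum (N : ℕ) (a : ℕ → ℝ) : IsH2H10 (∑ n ∈ Finset.range N, a n • sineMode n)
    (∑ n ∈ Finset.range N, (-freq n ^ 2 * a n) • sineMode n) := by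
  have h := (modalSum N a a).2
  change IsH2H10 ((modalSum N a a).1 0) ((modalSum N a a).1 1) at h
  rwa [modalSum_zero_coord, modalSum_one_coord] at h

theorem IsBiharmonic.of_isH2H10 {f f₂ g : L2} (h : IsH2H10 f f₂) (h' : IsH2H10 f₂ g) :
    IsBiharmonic f g := by
  obtain ⟨⟨f₁, h1, h2⟩, h3⟩ := h
  obtain ⟨⟨f₃, h4, h5⟩, h6⟩ := h'
  exact ⟨f₁, f₂, f₃, h1, h2, h4, h5, h3, h6⟩

theorem IsBiharmonic.inner_sineMode {f g : L2} (h : IsBiharmonic f g) (n : ℕ) :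
    inner ℝ (sineMode n) g = freq n ^ 4 * inner ℝ (sineMode n) f := by
  obtain ⟨f₁, f₂, f₃, h1, h2, h4, h5, h3, h6⟩ := h
  rw [IsH2H10.inner_sineMode (f := f₂) ⟨⟨f₃, h4, h5⟩, h6⟩,
    IsH2H10.inner_sineMode (f := f) ⟨⟨f₁, h1, h2⟩, h3⟩]
  ring

variable (Cd mu : ℝ)

/-- The modal coefficient of the acceleration. -/
def modalAccel (n : ℕ) : H →L[ℝ] ℝ :=
  -freq n ^ 4 • (modalCoeff 0 n + Cd • modalCoeff 2 n) - mu • modalCoeff 2 n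

theorem modalAccel_apply (n : ℕ) (z : H) : modalAccel Cd mu n z
    = -freq n ^ 4 * (modalCoeff 0 n z + Cd * modalCoeff 2 n z) - mu * modalCoeff 2 n z := rfl

/-- The projection onto the first `N` modes. -/
def modalProj (N : ℕ) : H →L[ℝ] H :=
  ∑ n ∈ Finset.range N,
    ((modalCoeff 0 n).smulRight (dispMode n) + (modalCoeff 2 n).smulRight (velMode n))

theorem modalProj_apply (N : ℕ) (z : H) :
    modalProj N z = modalSum N (fun n => modalCoeff 0 n z) fun n => modalCoeff 2 n z := by
  simp [modalProj, modalSum]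

/-- The restriction of the state operator to the first `N` modes. -/
def modalOp (N : ℕ) : H →L[ℝ] H :=
  ∑ n ∈ Finset.range N,
    ((modalCoeff 2 n).smulRight (dispMode n) + (modalAccel Cd mu n).smulRight (velMode n))

theorem modalOp_apply (N : ℕ) (z : H) :
    modalOp Cd mu N z = modalSum N (fun n => modalCoeff 2 n z) fun n => modalAccel Cd mu n z := by
  simp [modalOp, modalSum]

theorem isGenerator_modalSum (N : ℕ) (a b : ℕ → ℝ) :
    IsGenerator Cd mu (modalSum N a b)
      (modalSum N b fun n => -freq n ^ 4 * (a n + Cd * b n) - mu * b n) := by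
  have h1 := isH2H10_sum N fun n => a n + Cd * b n
  have h2 := isH2H10_sum N fun n => -freq n ^ 2 * (a n + Cd * b n)
  refine ⟨∑ n ∈ Finset.range N, (-freq n ^ 2 * b n) • sineMode n,
    ∑ n ∈ Finset.range N, (-freq n ^ 2 * (-freq n ^ 2 * (a n + Cd * b n))) • sineMode n,
    ?_, ?_, ?_, ?_⟩
  · rw [vel, modalSum_two_coord]
    exact isH2H10_sum N b
  · convert IsBiharmonic.of_isH2H10 h1 h2 using 1
    rw [disp, vel, modalSum_zero_coord, modalSum_two_coord, Finset.smul_sum,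
      ← Finset.sum_add_distrib]
    simp only [smul_smul, add_smul]
  · rw [disp, vel, modalSum_zero_coord, modalSum_two_coord]
  · rw [vel, vel, modalSum_two_coord, modalSum_two_coord, Finset.smul_sum,
      ← Finset.sum_neg_distrib, ← Finset.sum_sub_distrib]
    refine Finset.sum_congr rfl fun n _ => ?_
    rw [smul_smul, ← neg_smul, ← sub_smul]
    congr 1
    ring

/-- The weight `1 + freq n ^ 4` collects the terms `w²` and `(∂ₓₓ w)²` of the norm, since `∂ₓₓ`
multiplies a coefficient by `-freq n ^ 2`. -/
theorem inner_modalSum (N : ℕ) (a b : ℕ → ℝ) (z : H) :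
    inner ℝ (modalSum N a b) z = ∑ n ∈ Finset.range N,
      (a n * ((1 + freq n ^ 4) * modalCoeff 0 n z) + b n * modalCoeff 2 n z) := by
  have e : inner ℝ (modalSum N a b) z = inner ℝ ((modalSum N a b).1 0) (z.1 0)
      + inner ℝ ((modalSum N a b).1 1) (z.1 1) + inner ℝ ((modalSum N a b).1 2) (z.1 2) := by
    rw [Submodule.coe_inner, PiLp.inner_apply, Fin.sum_univ_three]
  rw [e, modalSum_zero_coord, modalSum_one_coord, modalSum_two_coord]
  simp only [sum_inner, real_inner_smul_left]
  rw [← Finset.sum_add_distrib, ← Finset.sum_add_distrib]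
  refine Finset.sum_congr rfl fun n _ => ?_
  rw [← modalCoeff_apply, ← modalCoeff_apply, ← modalCoeff_apply, modalCoeff_one]
  ring

theorem sum_modalCoeff_sq_le (N : ℕ) (z : H) :
    ∑ n ∈ Finset.range N, (modalCoeff 0 n z ^ 2 + modalCoeff 2 n z ^ 2) ≤ ‖z‖ ^ 2 := by
  have e : ‖z‖ ^ 2 = ‖z.1 0‖ ^ 2 + ‖z.1 1‖ ^ 2 + ‖z.1 2‖ ^ 2 := by
    rw [show ‖z‖ = ‖z.1‖ from rfl, PiLp.norm_sq_eq_of_L2, Fin.sum_univ_three]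
  have h : ∀ f : L2, ∑ n ∈ Finset.range N, inner ℝ (sineMode n) f ^ 2 ≤ ‖f‖ ^ 2 := fun f => by
    simpa only [Real.norm_eq_abs, sq_abs] using
      orthonormal_sineMode.sum_inner_products_le f (s := Finset.range N)
  rw [e, Finset.sum_add_distrib]
  have h0 := h (z.1 0)
  have h2 := h (z.1 2)
  simp only [modalCoeff_apply]
  nlinarith [sq_nonneg ‖z.1 1‖]

/-- Convergence in `H` also requires that of `∂ₓₓ w`. By `modalCoeff_one` the projection acts on
that coordinate as truncation of its own sine series. -/
theorem tendsto_modalProj (z : H) : Tendsto (fun N => modalProj N z) atTop (𝓝 z) := by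
  have hcoord : ∀ i : Fin 3, Tendsto (fun N => (modalProj N z).1 i) atTop (𝓝 (z.1 i)) := by
    intro i
    have h : ∀ i : Fin 3, Tendsto (fun N => ∑ n ∈ Finset.range N, modalCoeff i n z • sineMode n)
        atTop (𝓝 (z.1 i)) := fun i => tendsto_sum_sineMode (z.1 i)
    fin_cases i
    · simpa only [modalProj_apply, Fin.zero_eta, modalSum_zero_coord] using
        h 0
    · simpa only [modalProj_apply, Fin.mk_one, modalSum_one_coord, ← modalCoeff_one] using
        h 1
    · simpa only [modalProj_apply, Fin.reduceFinMk, modalSum_two_coord] using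
        h 2
  rw [tendsto_subtype_rng]
  exact ((PiLp.continuous_toLp 2 _).tendsto _).comp (tendsto_pi_nhds.2 hcoord)

/-- The beam operator admits a modal Galerkin approximation. -/
theorem isGalerkin_modal {Cd mu : ℝ} (hCd : 0 ≤ Cd) (hmu : 0 ≤ mu) :
    IsGalerkin (IsGenerator Cd mu) modalProj (modalOp Cd mu) (1 / 2) where
  gen_apply N z := by
    rw [modalProj_apply, modalOp_apply]
    exact isGenerator_modalSum Cd mu N _ _
  -- The boundary conditions in the domain allow integration by parts without boundary terms, so the
  -- sine coefficients of `y` are computed from those of `z`.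
  proj_eq N z y h := by
    obtain ⟨v₂, g, -, hg, hy0, hy2⟩ := h
    rw [modalProj_apply, modalOp_apply]
    refine modalSum_congr (fun n _ => ?_) fun n _ => ?_
    · exact congrArg (inner ℝ (sineMode n)) hy0
    · have h1 := hg.inner_sineMode n
      rw [modalCoeff_apply, show y.1 2 = _ from hy2, inner_sub_right, inner_neg_right, h1,
        inner_add_right, inner_smul_right, inner_smul_right, modalAccel_apply]
      change -(freq n ^ 4 * (modalCoeff 0 n z + Cd * modalCoeff 2 n z)) - mu * modalCoeff 2 n z = _
      ring
  tendsto_proj := tendsto_modalProj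
  proj_proj M N z hMN := by
    rw [modalProj_apply N, modalProj_apply M]
    simp only [modalCoeff_zero_modalSum, modalCoeff_two_modalSum]
    have hsub : Finset.range M ⊆ Finset.range N := Finset.range_subset_range.2 hMN
    rw [modalSum, ← Finset.sum_subset hsub fun n _ hn => by
      rw [if_neg (by simpa using hn), if_neg (by simpa using hn), zero_smul, zero_smul, add_zero]]
    exact modalSum_congr (fun n hn => if_pos hn) fun n hn => if_pos hn
  apply_proj N z := by
    rw [modalOp_apply, modalOp_apply]
    refine modalSum_congr (fun n hn => ?_) fun n hn => ?_
    · rw [modalProj_apply, modalCoeff_two_modalSum, if_pos hn]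
    · rw [modalAccel_apply, modalAccel_apply, modalProj_apply, modalCoeff_two_modalSum,
        modalCoeff_zero_modalSum, if_pos hn, if_pos hn]
  nonneg := by norm_num
  inner_le N z := by
    rw [modalOp_apply, inner_modalSum]
    -- With displacement and velocity coefficients `a`, `b`, the terms `freq n ^ 4 * a * b` cancel
    -- and damping contributes a nonpositive multiple of `b²`. Only `a * b`, from `w²` in the norm,
    -- remains; it is at most `½(a² + b²)`.
    have h : ∀ n ∈ Finset.range N, modalCoeff 2 n z * ((1 + freq n ^ 4) * modalCoeff 0 n z)
        + modalAccel Cd mu n z * modalCoeff 2 n z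
        ≤ 1 / 2 * (modalCoeff 0 n z ^ 2 + modalCoeff 2 n z ^ 2) := by
      intro n _
      rw [modalAccel_apply]
      have h1 : 0 ≤ (freq n ^ 4 * Cd + mu) * modalCoeff 2 n z ^ 2 := by positivity
      nlinarith [sq_nonneg (modalCoeff 0 n z - modalCoeff 2 n z)]
    refine (Finset.sum_le_sum h).trans ?_
    rw [← Finset.mul_sum]
    exact mul_le_mul_of_nonneg_left (sum_modalCoeff_sq_le N z) (by norm_num)

end ModalGalerkin

end Beam

end

/-! ### The main theorem. -/

theorem mainTheorem1 (Cd mu τ γ V c : ℝ) (hCd : 0 ≤ Cd) (hmu : 0 ≤ mu) (hτ : 0 < τ) (hγ : 0 < γ)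
    (hV : 0 < V) (hc0 : 0 < c) (hc1 : c < 1) :
    -- the admissible set is compact in the weak-* topology of `L^∞(0,1)`
    IsCompact (Beam.Kad V c) ∧
    -- operator norm of differences of input operators
    (∀ r₁ ∈ Beam.Kad V c, ∀ r₂ ∈ Beam.Kad V c,
      ‖Beam.inputOp r₂ - Beam.inputOp r₁‖
        = Real.sqrt (∫ x, (r₂.fn x - r₁.fn x) ^ 2 ∂Beam.unitMeasure)) ∧
    -- weak-* to operator norm continuity of the input operator on the admissible set
    ContinuousOn Beam.inputOp (Beam.Kad V c) ∧
    -- the optimal design problem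
    ∀ z₀ : Beam.H,
      (∀ r ∈ Beam.Kad V c, ∀ u : Lp ℝ 2 (Beam.timeMeasure τ),
        ∃! z : Lp Beam.H 2 (Beam.timeMeasure τ), Beam.IsWeakSolution Cd mu τ r u z₀ z) ∧
      (∀ r ∈ Beam.Kad V c,
        IsLeast (Beam.costValues Cd mu τ γ z₀ r) (Beam.J1 Cd mu τ γ z₀ r)) ∧
      ((Beam.Kad V c).Nonempty →
        ∃ r ∈ Beam.Kad V c, ∃ (u : Lp ℝ 2 (Beam.timeMeasure τ))
          (z : Lp Beam.H 2 (Beam.timeMeasure τ)),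
          Beam.IsWeakSolution Cd mu τ r u z₀ z ∧
          Beam.cost γ τ u z = Beam.J1 Cd mu τ γ z₀ r ∧
          ∀ r' ∈ Beam.Kad V c, Beam.J1 Cd mu τ γ z₀ r ≤ Beam.J1 Cd mu τ γ z₀ r') := by
  have hG := Beam.isGalerkin_modal hCd hmu
  have hleast : ∀ (z₀ : Beam.H) (r : Beam.K),
      IsLeast (Beam.costValues Cd mu τ γ z₀ r) (Beam.J1 Cd mu τ γ z₀ r) := by
    intro z₀ r
    rw [Beam.J1, Beam.costValues_eq hτ.le]
    exact hG.isLeast_lqCosts hτ.le hγ z₀ _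
  refine ⟨Beam.isCompact_Kad V c,
    fun r₁ _ r₂ _ => by rw [Beam.norm_inputOp_sub, Beam.norm_inputState_sub],
    Beam.Kad.continuousOn_inputOp hc0.le, fun z₀ => ⟨fun r _ u => ?_, fun r _ => hleast z₀ r,
    fun hne => ?_⟩⟩
  · obtain ⟨z, hz, -⟩ := hG.exists_weak hτ.le z₀ (Beam.inputState r) u
    exact ⟨z, (Beam.isWeakSolution_iff hτ.le).2 hz,
      fun y hy => hG.weak_unique hτ.le ((Beam.isWeakSolution_iff hτ.le).1 hy) hz⟩
  · obtain ⟨L, hL⟩ := hG.exists_sqrt_lqCosts_le hτ.le hγ z₀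
    -- Lipschitz dependence on the input vector composed with the weak-* continuity of `inputState`.
    -- Minimising the root is enough, as the costs are nonnegative.
    have hcont : ContinuousOn (fun r => √(Beam.J1 Cd mu τ γ z₀ r)) (Beam.Kad V c) := by
      simp only [Beam.J1, Beam.costValues_eq hτ.le]
      exact hL.continuous.comp_continuousOn (Beam.Kad.continuousOn_inputState hc0.le)
    obtain ⟨r, hr, hmin⟩ := (Beam.isCompact_Kad V c).exists_isMinOn hne hcont
    obtain ⟨u, z, hz, hJ⟩ := (hleast z₀ r).1
    have hJ0 : ∀ r, 0 ≤ Beam.J1 Cd mu τ γ z₀ r := by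
      intro r
      obtain ⟨u, z, -, hJ⟩ := (hleast z₀ r).1
      rw [hJ, Beam.cost_eq]
      positivity
    exact ⟨r, hr, u, z, hz, hJ.symm, fun r' hr' => (Real.sqrt_le_sqrt_iff (hJ0 r')).1 (hmin hr')⟩
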